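/- Let $G=(V,E)$ be any (simple) graph, and let $\mathcal X$ be the set of all finite subsets of $V$, ordered by inclusion. **Components, critical sets, ends.** For $X\in\mathcal X$ let $\mathcal C_X$ be the set of components of $G-X$, and for $Y\subseteq X$ let $\mathcal C_X(Y)$ be the set of those $C\in\mathcal C_X$ whose neighbourhood $N(C)$ is precisely $Y$. Call $X\in\mathcal X$ *critical* if $\mathcal C_X(X)$ is infinite. Let $\mathrm{crit}(G)$ be the set of all critical vertex sets, and $\mathrm{crit}(X)$ the set of all critical subsets of $X$. If $Y$ is critical and $Y\not\subseteq X\in\mathcal X$, there is a unique component $C_X(Y)$ of $G-X$ that meets $Y$. An *end* of $G$ is an equivalence class of rays (one-way infinite paths), where two rays are equivalent if for every $X\in\mathcal X$ both have a tail in the same component of $G-X$; for an end $\omega$, this component is denoted by $C(X,\omega)$. Let $\Omega$ be the set of ends of $G$. **The inverse system.** For $X\in\mathcal X$ let $\Gamma_X:=\mathcal C_X\sqcup\mathrm{crit}(X)$. For $X\subseteq X'\in\mathcal X$ let $f_{X',X}\colon\Gamma_{X'}\to\Gamma_X$ send each component of $G-X'$ to the component of $G-X$ including it, send each $Y\in\mathrm{crit}(X')$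 with $Y\subseteq X$ to itself, and send each other $Y\in\mathrm{crit}(X')$ to $C_X(Y)$. Let $\Gamma:=\varprojlim\Gamma_X$ be the inverse limit of the inverse system $\{\Gamma_X,f_{X',X},\mathcal X\}$. **Separations and tangles.** A *finite order separation* of $G$ is a set $\{A,B\}$ with $A\cup B=V$ and $A\cap B$ finite such that $G$ has no edge between $A\setminus B$ and $B\setminus A$; its orientations are $(A,B)$ and $(B,A)$. Write $(A,B)\le(C,D)$ if $A\subseteq C$ and $B\supseteq D$. For a set $S$ of such separations, an *orientation* of $S$ is a set of orientations of elements of $S$ that contains precisely one of $(A,B)$, $(B,A)$ for each $\{A,B\}\in S$; it is *consistent* if no two distinct elements $(B,A)$ and $(C,D)$ of it satisfy $(A,B)<(C,D)$. A *star* is a set $\sigma$ of oriented separations such that $(A,B)\le(C,D)$ for every two distinct $(A,B),(D,C)\in\sigma$; its *interior* is $\bigcap_{(A,B)\in\sigma}B$. For $X\in\mathcal X$ and $\mathcal C\subseteq\mathcal C_X$ let $V[\mathcal C]$ be the set of all vertices of the components in $\mathcal C$, and let $s_{X\to\mathcal C}:=(V\setminus V[\mathcal C],\,X\cup V[\mathcal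 C])$. Call $\mathcal C\subseteq\mathcal C_X$ *tame* if for no $Y\in\mathrm{crit}(X)$ both $\mathcal C_X(Y)\cap\mathcal C$ and $\mathcal C_X(Y)\setminus\mathcal C$ are infinite. A finite order separation is *tame* if it has the form $\{V\setminus V[\mathcal C],\,X\cup V[\mathcal C]\}$ with $X\in\mathcal X$ and both $\mathcal C$ and $\mathcal C_X\setminus\mathcal C$ tame. Let $S_t$ be the set of all tame finite order separations. An $\aleph_0$*-tangle of* $S_t$ is a consistent orientation of $S_t$ that has no subset that is a finite star of finite interior. Let $\Theta_t$ be the set of all $\aleph_0$-tangles of $S_t$. For $\tau\in\Theta_t$ and $X\in\mathcal X$ let $F(\tau,X)$ be the set of all tame $\mathcal C\subseteq\mathcal C_X$ with $s_{X\to\mathcal C}\in\tau$. **Theorem.** $\Theta_t=\Gamma=\Omega\sqcup\mathrm{crit}(G)$, in the following precise sense. 1. For every $\tau\in\Theta_t$ and $X\in\mathcal X$ there is a unique $\varphi_X(\tau)\in\Gamma_X$ such that either $\varphi_X(\tau)=C\in\mathcal C_X$ and $F(\tau,X)$ consists of all tame subsets of $\mathcal C_X$ that contain $C$, or $\varphi_X(\tau)=Y\in\mathrm{crit}(X)$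 and $F(\tau,X)$ consists of all tame subsets of $\mathcal C_X$ that include a cofinite subset of $\mathcal C_X(Y)$. The map $\tau\mapsto(\varphi_X(\tau)\mid X\in\mathcal X)$ is a bijection from $\Theta_t$ onto $\Gamma$. 2. The map $\Omega\sqcup\mathrm{crit}(G)\to\Gamma$ that sends an end $\omega$ to $(C(X,\omega)\mid X\in\mathcal X)$, and sends a critical vertex set $Y$ to the family whose entry at $X$ is $Y$ if $Y\subseteq X$ and $C_X(Y)$ otherwise, is a well-defined bijection. -/

import Mathlib

universe u

namespace EndsTangles

variable {V : Type u}

/-! ### Components, neighbourhoods and critical vertex sets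

For a finite set `X` of vertices, `G.ComponentCompl X` is the set of components of `G - X`. -/

/-- The neighbourhood `N(U)` of a set `U` of vertices. -/
def nbhd (G : SimpleGraph V) (U : Set V) : Set V :=
  {v | v ∉ U ∧ ∃ u ∈ U, G.Adj u v}

/-- The set of the components of `G - X` with neighbourhood precisely `Y`. -/
def compsWithNbhd (G : SimpleGraph V) (X Y : Finset V) : Set (G.ComponentCompl X) :=
  {C | nbhd G (C : Set V) = Y}

/-- `X` is critical if infinitely many components of `G - X` have neighbourhood precisely `X`. -/
def IsCritical (G : SimpleGraph V) (X : Finset V) : Prop :=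
  (compsWithNbhd G X X).Infinite

/-- `crit(G)`, the type of all critical vertex sets. -/
abbrev Crit (G : SimpleGraph V) : Type u := {Y : Finset V // IsCritical G Y}

/-- `crit(X)`, the type of all critical subsets of `X`. -/
abbrev CritSub (G : SimpleGraph V) (X : Finset V) : Type u :=
  {Y : Finset V // IsCritical G Y ∧ Y ⊆ X}

theorem IsCritical.exists_disjoint {G : SimpleGraph V} {Y : Finset V} (hY : IsCritical G Y)
    (X : Finset V) : ∃ D ∈ compsWithNbhd G Y Y, ∀ v ∈ D, v ∉ X := by
  by_contra! hcon
  have hV : Nonempty V := by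
    obtain ⟨D, -⟩ := hY.nonempty
    exact ⟨D.nonempty.choose⟩
  choose! f hf hfX using hcon
  refine hY (Set.Finite.of_finite_image (f := f) (X.finite_toSet.subset ?_) ?_)
  · rintro _ ⟨D, hD, rfl⟩
    exact hfX D hD
  · intro C hC D hD hCD
    by_contra hne
    have h : f C ∈ D := hCD ▸ hf D hD
    exact Set.disjoint_left.mp (SimpleGraph.ComponentCompl.pairwise_disjoint hne) (hf C hC) h

theorem componentComplMk_eq_of_walk {G : SimpleGraph V} {X Y : Set V}
    (D : G.ComponentCompl Y) (hD : ∀ v ∈ D, v ∉ X) {a b : ↥(Yᶜ)}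
    (p : (G.induce Yᶜ).Walk a b) (ha : (a : V) ∈ D) :
    ∃ (h : (a : V) ∉ X) (h' : (b : V) ∉ X), G.componentComplMk h = G.componentComplMk h' := by
  induction p with
  | nil => exact ⟨hD _ ha, hD _ ha, rfl⟩
  | @cons x y z hadj q ih =>
    have hy : (y : V) ∈ D :=
      SimpleGraph.ComponentCompl.mem_of_adj (x : V) (y : V) ha y.2 hadj
    obtain ⟨h, h', e⟩ := ih hy
    exact ⟨hD _ ha, h', (G.componentComplMk_eq_of_adj _ h hadj).trans e⟩

theorem componentComplMk_eq_of_mem {G : SimpleGraph V} {X Y : Set V}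
    (D : G.ComponentCompl Y) (hD : ∀ v ∈ D, v ∉ X) {a b : V} (ha : a ∈ D) (hb : b ∈ D) :
    G.componentComplMk (hD a ha) = G.componentComplMk (hD b hb) := by
  obtain ⟨haY, ea⟩ := ha
  obtain ⟨hbY, eb⟩ := hb
  obtain ⟨p⟩ := SimpleGraph.ConnectedComponent.exact (ea.trans eb.symm)
  obtain ⟨_, _, e⟩ := componentComplMk_eq_of_walk D hD p ⟨haY, ea⟩
  exact e

/-- If `Y` is critical and not included in `X`, a unique component of `G - X` meets `Y`. -/
theorem IsCritical.existsUnique_component {G : SimpleGraph V} {Y : Finset V}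
    (hY : IsCritical G Y) {X : Finset V} (hYX : ¬ Y ⊆ X) :
    ∃! C : G.ComponentCompl X, ∃ v ∈ Y, v ∈ C := by
  obtain ⟨y, hy, hyX⟩ := Finset.not_subset.mp hYX
  have hyX' : y ∉ (X : Set V) := hyX
  obtain ⟨D, hDY, hD⟩ := hY.exists_disjoint X
  have hD' : ∀ v ∈ D, v ∉ (X : Set V) := hD
  have key : ∀ v ∈ Y, ∃ d ∈ D, G.Adj d v := fun v hv => by
    have : v ∈ nbhd G (D : Set V) := by rw [hDY]; exact hv
    exact this.2
  refine ⟨G.componentComplMk hyX', ⟨y, hy, G.componentComplMk_mem hyX'⟩, ?_⟩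
  rintro C ⟨w, hw, hwX, rfl⟩
  obtain ⟨d, hd, hdy⟩ := key y hy
  obtain ⟨e, he, hew⟩ := key w hw
  rw [← G.componentComplMk_eq_of_adj (hD' d hd) hyX' hdy,
    ← G.componentComplMk_eq_of_adj (hD' e he) hwX hew]
  exact componentComplMk_eq_of_mem D hD' he hd

/-- `C_X(Y)`: the unique component of `G - X` meeting the critical set `Y`, for `Y ⊈ X`. -/
noncomputable def critComp {G : SimpleGraph V} {Y : Finset V} (hY : IsCritical G Y)
    {X : Finset V} (hYX : ¬ Y ⊆ X) : G.ComponentCompl X :=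
  (hY.existsUnique_component hYX).choose

theorem critComp_spec {G : SimpleGraph V} {Y : Finset V} (hY : IsCritical G Y)
    {X : Finset V} (hYX : ¬ Y ⊆ X) : ∃ v ∈ Y, v ∈ critComp hY hYX :=
  (hY.existsUnique_component hYX).choose_spec.1

theorem eq_critComp {G : SimpleGraph V} {Y : Finset V} (hY : IsCritical G Y)
    {X : Finset V} (hYX : ¬ Y ⊆ X) {C : G.ComponentCompl X} (hC : ∃ v ∈ Y, v ∈ C) :
    C = critComp hY hYX :=
  (hY.existsUnique_component hYX).unique hC (critComp_spec hY hYX)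

/-! ### The inverse system `Γ_X = 𝒞_X ⊔ crit(X)` and its limit -/

/-- `Γ_X`, the disjoint union of the set of components of `G - X` and `crit(X)`. -/
abbrev GammaAt (G : SimpleGraph V) (X : Finset V) : Type u :=
  G.ComponentCompl X ⊕ CritSub G X

open Classical in
/-- The bonding map `f_{X',X} : Γ_{X'} → Γ_X` for `X ⊆ X'`: a component of `G - X'` is sent to
the component of `G - X` including it, a critical set `Y ⊆ X` to itself, and a critical
set `Y ⊈ X` to the component of `G - X` that meets it. -/
noncomputable def bonding (G : SimpleGraph V) {X X' : Finset V} (h : X ⊆ X') :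
    GammaAt G X' → GammaAt G X
  | Sum.inl C => Sum.inl (C.hom (Finset.coe_subset.mpr h))
  | Sum.inr Y =>
      if hY : Y.1 ⊆ X then Sum.inr ⟨Y.1, Y.2.1, hY⟩ else Sum.inl (critComp Y.2.1 hY)

theorem bonding_refl (G : SimpleGraph V) (X : Finset V) (ξ : GammaAt G X) :
    bonding G (Finset.Subset.refl X) ξ = ξ := by
  rcases ξ with C | Y
  · exact congrArg Sum.inl C.hom_refl
  · simp [bonding, Y.2.2]

theorem bonding_trans (G : SimpleGraph V) {X X' X'' : Finset V} (h : X ⊆ X') (h' : X' ⊆ X'')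
    (ξ : GammaAt G X'') :
    bonding G h (bonding G h' ξ) = bonding G (h.trans h') ξ := by
  rcases ξ with C | ⟨Y, hY, hYX⟩
  · exact congrArg Sum.inl (C.hom_trans (Finset.coe_subset.mpr h') (Finset.coe_subset.mpr h)).symm
  · by_cases h1 : Y ⊆ X
    · simp [bonding, h1, h1.trans h]
    · by_cases h2 : Y ⊆ X'
      · simp [bonding, h1, h2]
      · simp only [bonding, h1, h2, dite_false]
        refine congrArg Sum.inl (eq_critComp hY h1 ?_)
        obtain ⟨v, hv, hvC⟩ := critComp_spec hY h2
        exact ⟨v, hv, SimpleGraph.ComponentCompl.subset_hom _ (Finset.coe_subset.mpr h) hvC⟩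

/-- `Γ`, the inverse limit of the sets `Γ_X`, indexed by the finite sets `X` of vertices. -/
def Gamma (G : SimpleGraph V) : Type u :=
  {p : ∀ X : Finset V, GammaAt G X // ∀ (X X' : Finset V) (h : X ⊆ X'), bonding G h (p X') = p X}

open Classical in
/-- The limit `⟨Y⟩` of a critical vertex set `Y`: its coordinate at `X` is `Y` if `Y ⊆ X`,
and `C_X(Y)` otherwise. -/
noncomputable def critLimit (G : SimpleGraph V) (Y : Crit G) : Gamma G :=
  ⟨fun X => if hY : Y.1 ⊆ X then Sum.inr ⟨Y.1, Y.2, hY⟩ else Sum.inl (critComp Y.2 hY), by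
    intro X X' h
    have key : ∀ Z : Finset V, (if hY : Y.1 ⊆ Z then Sum.inr ⟨Y.1, Y.2, hY⟩
        else Sum.inl (critComp Y.2 hY) : GammaAt G Z) =
        bonding G (Finset.subset_union_left : Z ⊆ Z ∪ (X' ∪ Y.1))
          (Sum.inr ⟨Y.1, Y.2, Finset.subset_union_right.trans Finset.subset_union_right⟩) :=
      fun Z => rfl
    by_cases h2 : Y.1 ⊆ X'
    · simp only [h2, dite_true]; rfl
    · have h1 : ¬ Y.1 ⊆ X := fun h1 => h2 (h1.trans h)
      simp only [h1, h2, dite_false]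
      refine congrArg Sum.inl (eq_critComp Y.2 h1 ?_)
      obtain ⟨v, hv, hvC⟩ := critComp_spec Y.2 h2
      exact ⟨v, hv, SimpleGraph.ComponentCompl.subset_hom _ (Finset.coe_subset.mpr h) hvC⟩⟩

/-! ### Ends, as equivalence classes of rays -/

/-- A ray: a one-way infinite path. -/
structure Ray (G : SimpleGraph V) where
  /-- The sequence of vertices of the ray. -/
  vert : ℕ → V
  injective : Function.Injective vert
  adj : ∀ n, G.Adj (vert n) (vert (n + 1))

/-- The ray `r` has a tail in the component `C` of `G - X`. -/
def Ray.HasTailIn {G : SimpleGraph V} (r : Ray G) {X : Finset V} (C : G.ComponentCompl X) : Prop :=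
  ∃ n, ∀ m, n ≤ m → r.vert m ∈ C

theorem Ray.existsUnique_hasTailIn {G : SimpleGraph V} (r : Ray G) (X : Finset V) :
    ∃! C : G.ComponentCompl X, r.HasTailIn C := by
  have hfin : {n | r.vert n ∈ X}.Finite := X.finite_toSet.preimage r.injective.injOn
  obtain ⟨N, hN⟩ := hfin.bddAbove
  have hout : ∀ m, N + 1 ≤ m → r.vert m ∉ (X : Set V) := fun m hm hmX => by
    have := hN (show m ∈ {n | r.vert n ∈ X} from hmX)
    omega
  refine ⟨G.componentComplMk (hout (N + 1) le_rfl), ⟨N + 1, fun m hm => ?_⟩, ?_⟩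
  · induction m, hm using Nat.le_induction with
    | base => exact G.componentComplMk_mem _
    | succ k hk ih =>
      exact SimpleGraph.ComponentCompl.mem_of_adj _ _ ih (hout (k + 1) (by omega)) (r.adj k)
  · rintro C ⟨n, hn⟩
    have hC := hn (max n (N + 1)) (le_max_left _ _)
    have hD : r.vert (max n (N + 1)) ∈ G.componentComplMk (hout (N + 1) le_rfl) := by
      have : ∀ m, N + 1 ≤ m → r.vert m ∈ G.componentComplMk (hout (N + 1) le_rfl) := by
        intro m hm
        induction m, hm using Nat.le_induction with
        | base => exact G.componentComplMk_mem _
        | succ k hk ih =>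
          exact SimpleGraph.ComponentCompl.mem_of_adj _ _ ih (hout (k + 1) (by omega)) (r.adj k)
      exact this _ (le_max_right _ _)
    exact hC.choose_spec.symm.trans hD.choose_spec

/-- Two rays are equivalent if, for every finite `X`, both have a tail in the same component
of `G - X`. -/
def rayEquiv {G : SimpleGraph V} (r s : Ray G) : Prop :=
  ∀ X : Finset V, ∃ C : G.ComponentCompl X, r.HasTailIn C ∧ s.HasTailIn C

/-- Equivalence of rays, as a setoid. -/
def raySetoid (G : SimpleGraph V) : Setoid (Ray G) where
  r := rayEquiv
  iseqv :=
    { refl := fun r X => by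
        obtain ⟨C, hC, -⟩ := r.existsUnique_hasTailIn X
        exact ⟨C, hC, hC⟩
      symm := fun h X => by
        obtain ⟨C, h1, h2⟩ := h X
        exact ⟨C, h2, h1⟩
      trans := fun {r s t} h h' X => by
        obtain ⟨C, h1, h2⟩ := h X
        obtain ⟨D, h3, h4⟩ := h' X
        obtain rfl := (s.existsUnique_hasTailIn X).unique h2 h3
        exact ⟨C, h1, h4⟩ }

/-- `Ω(G)`, the type of ends of `G`. -/
def End (G : SimpleGraph V) : Type u := Quotient (raySetoid G)

/-- The component `C(X,ω)` of `G - X` in which every ray of the end `ω` has a tail. -/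
noncomputable def endComp {G : SimpleGraph V} (X : Finset V) (ω : End G) : G.ComponentCompl X :=
  Quotient.lift (s := raySetoid G) (fun r : Ray G => (r.existsUnique_hasTailIn X).choose)
    (fun r s h => by
      obtain ⟨C, h1, h2⟩ := h X
      exact ((r.existsUnique_hasTailIn X).unique
        (r.existsUnique_hasTailIn X).choose_spec.1 h1).trans
        ((s.existsUnique_hasTailIn X).unique h2 (s.existsUnique_hasTailIn X).choose_spec.1)) ω

theorem Ray.hasTailIn_endComp {G : SimpleGraph V} (r : Ray G) (X : Finset V) :
    r.HasTailIn (endComp X (Quotient.mk (raySetoid G) r)) :=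
  (r.existsUnique_hasTailIn X).choose_spec.1

/-- The limit `(C(X,ω))_X` defined by an end `ω`. -/
noncomputable def endLimit (G : SimpleGraph V) (ω : End G) : Gamma G :=
  ⟨fun X => Sum.inl (endComp X ω), by
    intro X X' h
    refine Quotient.inductionOn ω (fun r => congrArg Sum.inl ?_)
    obtain ⟨n, hn⟩ := r.hasTailIn_endComp X'
    exact (r.existsUnique_hasTailIn X).unique
      ⟨n, fun m hm => SimpleGraph.ComponentCompl.subset_hom _ (Finset.coe_subset.mpr h) (hn m hm)⟩
      (r.hasTailIn_endComp X)⟩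

/-! ### Separations, stars and tangles -/

/-- An oriented finite order separation `(A, B)`, with small side `A` and big side `B`. -/
@[ext]
structure Separation (G : SimpleGraph V) where
  /-- The small side. -/
  small : Set V
  /-- The big side. -/
  big : Set V
  union_eq : small ∪ big = Set.univ
  finite_inter : (small ∩ big).Finite
  not_adj : ∀ a ∈ small \ big, ∀ b ∈ big \ small, ¬ G.Adj a b

namespace Separation

variable {G : SimpleGraph V}

/-- The other orientation `(B, A)` of the separation `{A, B}`. -/
def swap (s : Separation G) : Separation G where
  small := s.big
  big := s.small
  union_eq := by rw [Set.union_comm, s.union_eq]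
  finite_inter := by rw [Set.inter_comm]; exact s.finite_inter
  not_adj := fun a ha b hb hab => s.not_adj b hb a ha hab.symm

/-- `(A, B) ≤ (C, D)` if and only if `A ⊆ C` and `B ⊇ D`. -/
instance : PartialOrder (Separation G) where
  le s t := s.small ⊆ t.small ∧ t.big ⊆ s.big
  le_refl s := ⟨subset_rfl, subset_rfl⟩
  le_trans s t r h h' := ⟨h.1.trans h'.1, h'.2.trans h.2⟩
  le_antisymm s t h h' :=
    Separation.ext (Set.Subset.antisymm h.1 h'.1) (Set.Subset.antisymm h'.2 h.2)

end Separation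

/-- A star: a set of oriented separations any two distinct elements of which point
towards each other. -/
def IsStar {G : SimpleGraph V} (σ : Set (Separation G)) : Prop :=
  ∀ s ∈ σ, ∀ t ∈ σ, s ≠ t → s ≤ t.swap

/-- The interior of a star: the intersection of all big sides. -/
def starInterior {G : SimpleGraph V} (σ : Set (Separation G)) : Set V :=
  ⋂ s ∈ σ, s.big

/-- `O` is an orientation of `S`: it consists of orientations of elements of `S`, and contains
precisely one of `(A, B)` and `(B, A)` for every `{A, B}` in `S`. Here `S`, a set of unoriented
separations, is given by the set of all the orientations of its elements. -/
def IsOrientation {G : SimpleGraph V} (S O : Set (Separation G)) : Prop :=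
  O ⊆ S ∧ ∀ s ∈ S, ∃! t, (t = s ∨ t = s.swap) ∧ t ∈ O

/-- No two distinct elements `(B, A)` and `(C, D)` of `O` satisfy `(A, B) < (C, D)`. -/
def IsConsistent {G : SimpleGraph V} (O : Set (Separation G)) : Prop :=
  ∀ s ∈ O, ∀ t ∈ O, s ≠ t → ¬ s.swap < t

/-- An `ℱ`-tangle of `S`: a consistent orientation of `S` no subset of which belongs to `ℱ`. -/
structure IsTangle {G : SimpleGraph V} (S : Set (Separation G)) (ℱ : Set (Set (Separation G)))
    (O : Set (Separation G)) : Prop where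
  orientation : IsOrientation S O
  consistent : IsConsistent O
  avoids : ∀ σ ⊆ O, σ ∉ ℱ

/-- The finite stars in `S` of finite interior. -/
def finiteStars {G : SimpleGraph V} (S : Set (Separation G)) : Set (Set (Separation G)) :=
  {σ | σ ⊆ S ∧ IsStar σ ∧ σ.Finite ∧ (starInterior σ).Finite}

/-! ### Tame separations and the `ℵ₀`-tangles of `S_t` -/

/-- `V[𝒞]`, the set of all vertices of the components in `𝒞`. -/
def verts {G : SimpleGraph V} {X : Finset V} (𝒞 : Set (G.ComponentCompl X)) : Set V :=
  ⋃ C ∈ 𝒞, (C : Set V)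

theorem notMem_of_mem_verts {G : SimpleGraph V} {X : Finset V} {𝒞 : Set (G.ComponentCompl X)}
    {v : V} (hv : v ∈ verts 𝒞) : v ∉ X := by
  simp only [verts, Set.mem_iUnion] at hv
  obtain ⟨C, -, hvC⟩ := hv
  exact SimpleGraph.ComponentCompl.notMem_of_mem hvC

/-- The oriented separation `s_{X → 𝒞} = (V \ V[𝒞], X ∪ V[𝒞])`. -/
def sepTo {G : SimpleGraph V} (X : Finset V) (𝒞 : Set (G.ComponentCompl X)) : Separation G where
  small := (verts 𝒞)ᶜ
  big := ↑X ∪ verts 𝒞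
  union_eq := by
    ext v
    by_cases h : v ∈ verts 𝒞 <;> simp [h]
  finite_inter := X.finite_toSet.subset (by
    rintro v ⟨h1, h2 | h2⟩
    · exact h2
    · exact absurd h2 h1)
  not_adj := by
    rintro a ⟨ha, ha'⟩ b ⟨-, hb⟩ hab
    have hb' : b ∈ verts 𝒞 := not_not.mp hb
    simp only [verts, Set.mem_iUnion] at hb'
    obtain ⟨C, hC, hbC⟩ := hb'
    refine ha ?_
    simp only [verts, Set.mem_iUnion]
    exact ⟨C, hC, SimpleGraph.ComponentCompl.mem_of_adj b a hbC
      (fun h => ha' (Or.inl h)) hab.symm⟩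

/-- A set `𝒞` of components of `G - X` is tame if for no critical `Y ⊆ X` both `𝒞` and its
complement contain infinitely many components with neighbourhood precisely `Y`. -/
def IsTame {G : SimpleGraph V} {X : Finset V} (𝒞 : Set (G.ComponentCompl X)) : Prop :=
  ∀ Y : Finset V, IsCritical G Y → Y ⊆ X →
    ¬ ((compsWithNbhd G X Y ∩ 𝒞).Infinite ∧ (compsWithNbhd G X Y ∩ 𝒞ᶜ).Infinite)

/-- The (orientations of the) tame finite order separations `S_t`: those that correspond to a
bipartition `{𝒞, 𝒞ᶜ}` of the set of components of `G - X`, for a finite `X`, into two tame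
sets. -/
def tameSeps (G : SimpleGraph V) : Set (Separation G) :=
  {s | ∃ (X : Finset V) (𝒞 : Set (G.ComponentCompl X)), IsTame 𝒞 ∧ IsTame 𝒞ᶜ ∧ s = sepTo X 𝒞}

theorem verts_compl {G : SimpleGraph V} {X : Finset V} (𝒞 : Set (G.ComponentCompl X)) :
    verts 𝒞ᶜ = ((X : Set V) ∪ verts 𝒞)ᶜ := by
  ext v
  simp only [verts, Set.mem_iUnion, Set.mem_compl_iff, Set.mem_union, not_or, not_exists]
  constructor
  · rintro ⟨C, hC, hv⟩
    refine ⟨SimpleGraph.ComponentCompl.notMem_of_mem hv, fun D hD hvD => hC ?_⟩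
    obtain ⟨_, rfl⟩ := hv
    obtain ⟨_, rfl⟩ := hvD
    exact hD
  · rintro ⟨hvX, hv⟩
    exact ⟨G.componentComplMk hvX, fun h => hv _ h (G.componentComplMk_mem hvX),
      G.componentComplMk_mem hvX⟩

theorem swap_sepTo {G : SimpleGraph V} (X : Finset V) (𝒞 : Set (G.ComponentCompl X)) :
    (sepTo X 𝒞).swap = sepTo X 𝒞ᶜ := by
  refine Separation.ext ?_ ?_
  · simp only [Separation.swap, sepTo, verts_compl, compl_compl]
  · ext v
    have := @notMem_of_mem_verts V G X 𝒞 v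
    simp only [Separation.swap, sepTo, verts_compl, Set.mem_compl_iff, Set.mem_union,
      Finset.mem_coe]
    tauto

theorem swap_mem_tameSeps {G : SimpleGraph V} {s : Separation G} (hs : s ∈ tameSeps G) :
    s.swap ∈ tameSeps G := by
  obtain ⟨X, 𝒞, h, h', rfl⟩ := hs
  exact ⟨X, 𝒞ᶜ, h', by rwa [compl_compl], swap_sepTo X 𝒞⟩

/-- Every finite order separation is `s_{X → 𝒞}` for `X = A ∩ B` and a set `𝒞` of components. -/
theorem exists_eq_sepTo {G : SimpleGraph V} (s : Separation G) :
    ∃ (X : Finset V) (𝒞 : Set (G.ComponentCompl X)),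
      (X : Set V) = s.small ∩ s.big ∧ s = sepTo X 𝒞 := by
  obtain ⟨X, hX⟩ := s.finite_inter.exists_finset_coe
  have huniv : ∀ v, v ∈ s.small ∨ v ∈ s.big := fun v => by
    have : v ∈ s.small ∪ s.big := by rw [s.union_eq]; trivial
    exact this
  have hXmem : ∀ v, v ∈ (X : Set V) ↔ v ∈ s.small ∧ v ∈ s.big := fun v => by rw [hX]; rfl
  have hclosed : ∀ {a b : ↥((X : Set V)ᶜ)} (p : (G.induce (X : Set V)ᶜ).Walk a b),
      (a : V) ∈ s.big → (b : V) ∈ s.big := by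
    intro a b p
    induction p with
    | nil => exact id
    | @cons x y z hadj q ih =>
      intro hx
      refine ih (by_contra fun hy => ?_)
      have hx' : (x : V) ∉ s.small := fun h => x.2 ((hXmem _).mpr ⟨h, hx⟩)
      exact s.not_adj y ⟨(huniv y).resolve_right hy, hy⟩ x ⟨hx, hx'⟩ (SimpleGraph.Adj.symm hadj)
  have hverts : verts {C : G.ComponentCompl X | (C : Set V) ⊆ s.big} = s.big \ X := by
    ext v
    simp only [verts, Set.mem_iUnion]
    constructor
    · rintro ⟨C, hC, hv⟩
      exact ⟨hC hv, SimpleGraph.ComponentCompl.notMem_of_mem hv⟩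
    · rintro ⟨hv, hvX⟩
      refine ⟨G.componentComplMk hvX, ?_, G.componentComplMk_mem hvX⟩
      rintro w ⟨hwX, hw⟩
      obtain ⟨p⟩ := SimpleGraph.ConnectedComponent.exact hw.symm
      exact hclosed p hv
  refine ⟨X, {C | (C : Set V) ⊆ s.big}, hX, Separation.ext ?_ ?_⟩
  · ext v
    simp only [sepTo, hverts, Set.mem_compl_iff, Set.mem_sdiff, hXmem]
    have := huniv v
    tauto
  · ext v
    simp only [sepTo, hverts, Set.mem_union, Set.mem_sdiff, hXmem]
    tauto

/-- `Θ_t`, the set of all `ℵ₀`-tangles of `S_t`: the tangles of `S_t` that avoid the finite stars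
in `S_t` of finite interior. -/
def Theta (G : SimpleGraph V) : Set (Set (Separation G)) :=
  {τ | IsTangle (tameSeps G) (finiteStars (tameSeps G)) τ}

/-- The filter `F(τ, X)` of the tame `𝒞` with `s_{X → 𝒞} ∈ τ`. -/
def tangleFilter {G : SimpleGraph V} (τ : Set (Separation G)) (X : Finset V) :
    Set (Set (G.ComponentCompl X)) :=
  {𝒞 | IsTame 𝒞 ∧ sepTo X 𝒞 ∈ τ}

/-- The filter on the poset of tame sets of components of `G - X` given by an element of `Γ_X`:
for a component `C` this is the principal filter at `{C}`, and for a critical set `Y ⊆ X` it is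
the up-closure of the set of cofinite subsets of the set of components with neighbourhood `Y`. -/
def gammaFilter {G : SimpleGraph V} {X : Finset V} : GammaAt G X → Set (Set (G.ComponentCompl X))
  | Sum.inl C => {𝒟 | IsTame 𝒟 ∧ {C} ⊆ 𝒟}
  | Sum.inr Y => {𝒟 | IsTame 𝒟 ∧ ∃ ℰ ⊆ compsWithNbhd G X Y.1,
      (compsWithNbhd G X Y.1 \ ℰ).Finite ∧ ℰ ⊆ 𝒟}

end EndsTangles

namespace EndsTangles

variable {V : Type u} {G : SimpleGraph V}

open Filter

/-! ### Components of `G - X` -/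

/-! The tame subsets of 𝒞_X form a Boolean algebra whose ultrafilters are the elements of Γ_X. Each
ξ in Γ_X is encoded by a genuine filter `gammaNhds ξ` on 𝒞_X: principal for a component, cofinite on
𝒞_X(Y) for a critical Y. A set is tame exactly if all these filters decide it (`isTame_iff`), and
the bonding maps are push-forwards of filters (`gammaNhds_bonding`).

From tangles to limits: stars of at most three separations show that F(τ, X) is an ultrafilter of
tame sets (`inter_mem_tangleFilter`, `empty_notMem_tangleFilter`). The neighbourhoods N(C) partition
𝒞_X into finitely many classes, so F(τ, X) contains one class 𝒞_X(Y). If F(τ, X) has a finite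
element, it is generated by one component; otherwise Y is critical and F(τ, X) is the cofinite
filter on that class, restricted to tame sets. These choices are compatible by
`preimage_hom_mem_tangleFilter`. Conversely, finitely many separations oriented by an element of Γ
can be compared at one large finite set W, where a single component lies in all their big sides; so
no finite interior can arise (`exists_forall_mem_big`).

For the second bijection, one critical coordinate determines the whole limit. All other limits are
directions, that is, compatible choices of components f X. If infinitely many vertices dominate f,
in that they lie in f X whenever they are outside X, a ray is built by linking such vertices with
walks that avoid the earlier ones. If only finitely many do, there are X_0 ⊆ X_1 ⊆ … for which the f
(X_n) have empty intersection, and walks inside these sets give the ray. Both cases end in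
`exists_end_of_walks`. -/

theorem eq_of_mem_of_mem {K : Set V} {C D : G.ComponentCompl K} {v : V} (hC : v ∈ C)
    (hD : v ∈ D) : C = D := by
  obtain ⟨_, rfl⟩ := hC
  obtain ⟨_, rfl⟩ := hD
  rfl

theorem finite_setOf_meets (K : Set V) (Z : Finset V) :
    {C : G.ComponentCompl K | ∃ v ∈ Z, v ∈ C}.Finite := by
  have h : {C : G.ComponentCompl K | ∃ v ∈ Z, v ∈ C} =
      ⋃ v ∈ (Z : Set V), {C : G.ComponentCompl K | v ∈ C} := by
    ext C
    simp
  rw [h]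
  exact Z.finite_toSet.biUnion fun v _ =>
    Set.Subsingleton.finite fun C hC D hD => eq_of_mem_of_mem hC hD

theorem mem_of_walk {K : Set V} {C : G.ComponentCompl K} {a b : V} (p : G.Walk a b)
    (ha : a ∈ C) (hp : ∀ v ∈ p.support, v ∉ K) : ∀ v ∈ p.support, v ∈ C := by
  induction p with
  | nil => simpa using ha
  | @cons x y z hadj q ih =>
    intro v hv
    rw [SimpleGraph.Walk.support_cons, List.mem_cons] at hv
    rcases hv with rfl | hv
    · exact ha
    · exact ih (SimpleGraph.ComponentCompl.mem_of_adj x y ha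
        (hp y (by simp)) hadj) (fun w hw => hp w (by simp [hw])) v hv

theorem exists_walk_of_mem {K : Set V} {C : G.ComponentCompl K} {a b : V} (ha : a ∈ C)
    (hb : b ∈ C) : ∃ p : G.Walk a b, ∀ v ∈ p.support, v ∈ C := by
  obtain ⟨haK, ea⟩ := id ha
  obtain ⟨hbK, eb⟩ := id hb
  obtain ⟨p⟩ := SimpleGraph.ConnectedComponent.exact (ea.trans eb.symm)
  refine ⟨p.map (SimpleGraph.Embedding.induce Kᶜ).toHom, mem_of_walk _ ha fun v hv => ?_⟩
  obtain ⟨w, -, rfl⟩ := List.mem_map.mp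
    ((congrArg (v ∈ ·) (SimpleGraph.Walk.support_map _ _)).mp hv)
  exact w.2

theorem subset_of_disjoint {K L : Set V} (C : G.ComponentCompl K) (D : G.ComponentCompl L)
    (hD : ∀ v ∈ D, v ∉ K) {v : V} (hvC : v ∈ C) (hvD : v ∈ D) : (D : Set V) ⊆ C := by
  intro w hw
  obtain ⟨p, hp⟩ := exists_walk_of_mem hvD hw
  exact mem_of_walk p hvC (fun x hx => hD x (hp x hx)) w p.end_mem_support

theorem mem_hom {K L : Set V} {C : G.ComponentCompl L} (h : K ⊆ L) {v : V} (hv : v ∈ C) :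
    v ∈ C.hom h :=
  C.subset_hom h hv

theorem nbhd_subset {K : Set V} (C : G.ComponentCompl K) : nbhd G (C : Set V) ⊆ K := by
  rintro v ⟨hv, u, hu, huv⟩
  by_contra hvK
  exact hv (SimpleGraph.ComponentCompl.mem_of_adj u v hu hvK huv)

/-- A walk can leave C only through N(C), so a walk avoiding K ⊇ N(C) stays in C: putting back the
vertices of L \ K does not enlarge C. -/
theorem coe_hom_of_nbhd_subset {K L : Set V} (h : K ⊆ L) (C : G.ComponentCompl L)
    (hC : nbhd G (C : Set V) ⊆ K) : (C.hom h : Set V) = C := by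
  refine Set.Subset.antisymm (fun w hw => ?_) (C.subset_hom h)
  obtain ⟨v, hv⟩ := C.nonempty
  obtain ⟨p, hp⟩ := exists_walk_of_mem (mem_hom h hv) hw
  have key : ∀ {a b : V} (p : G.Walk a b), a ∈ C → (∀ v ∈ p.support, v ∉ K) → b ∈ C := by
    intro a b p
    induction p with
    | nil => exact fun h _ => h
    | @cons x y z hadj q ih =>
      intro hx hq
      refine ih (by_contra fun hy => ?_) fun w hw => hq w (by simp [hw])
      exact hq y (by simp) (hC ⟨hy, x, hx, hadj⟩)
  exact key p hv fun x hx => SimpleGraph.ComponentCompl.notMem_of_mem (hp x hx)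

theorem exists_hom_eq_of_disjoint {K L : Set V} (h : K ⊆ L) (C : G.ComponentCompl K)
    (hC : ∀ v ∈ C, v ∉ L) : ∃ D : G.ComponentCompl L, D.hom h = C ∧ (D : Set V) = C := by
  obtain ⟨v, hv⟩ := C.nonempty
  have hvD := G.componentComplMk_mem (hC v hv)
  have e : (G.componentComplMk (hC v hv)).hom h = C := eq_of_mem_of_mem (mem_hom h hvD) hv
  refine ⟨_, e, Set.Subset.antisymm ?_ (subset_of_disjoint _ C hC hvD hv)⟩
  conv_rhs => rw [← e]
  exact SimpleGraph.ComponentCompl.subset_hom _ h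

theorem hom_mem_compsWithNbhd {X X' Y : Finset V} (h : X ⊆ X') (hY : Y ⊆ X)
    {C : G.ComponentCompl X'} (hC : C ∈ compsWithNbhd G X' Y) :
    C.hom (Finset.coe_subset.mpr h) ∈ compsWithNbhd G X Y := by
  have e := coe_hom_of_nbhd_subset (Finset.coe_subset.mpr h) C
    ((le_of_eq hC).trans (Finset.coe_subset.mpr hY))
  change nbhd G _ = _
  rw [e]
  exact hC

theorem injOn_hom_compsWithNbhd {X X' Y : Finset V} (h : X ⊆ X') (hY : Y ⊆ X) :
    Set.InjOn (fun C : G.ComponentCompl X' => C.hom (Finset.coe_subset.mpr h))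
      (compsWithNbhd G X' Y) := by
  intro C hC D hD e
  have key : ∀ E ∈ compsWithNbhd G X' Y, (E.hom (Finset.coe_subset.mpr h) : Set V) = E :=
    fun E hE => coe_hom_of_nbhd_subset _ E
      ((le_of_eq hE).trans (Finset.coe_subset.mpr hY))
  rw [← SimpleGraph.ComponentCompl.coe_inj, ← key C hC, ← key D hD]
  exact congrArg _ e

theorem isCritical_of_infinite {X Y : Finset V} (h : Y ⊆ X)
    (hX : (compsWithNbhd G X Y).Infinite) : IsCritical G Y := by
  refine (hX.image (injOn_hom_compsWithNbhd h subset_rfl)).mono ?_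
  rintro _ ⟨C, hC, rfl⟩
  exact hom_mem_compsWithNbhd h subset_rfl hC

theorem exists_mem_compsWithNbhd {X : Finset V} (C : G.ComponentCompl X) :
    ∃ Y ⊆ X, C ∈ compsWithNbhd G X Y := by
  classical
  refine ⟨X.filter (· ∈ nbhd G (C : Set V)), X.filter_subset _, ?_⟩
  ext v
  simpa using fun h => nbhd_subset C h

/-! ### Elements of `Γ_X` as filters on the set of components of `G - X` -/

/-- The filter on the set of components of `G - X` defined by an element of `Γ_X`. -/
def gammaNhds {X : Finset V} : GammaAt G X → Filter (G.ComponentCompl X)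
  | Sum.inl C => pure C
  | Sum.inr Y => cofinite ⊓ 𝓟 (compsWithNbhd G X Y.1)

theorem mem_cofinite_inf_principal {α : Type*} {s t : Set α} :
    s ∈ cofinite ⊓ 𝓟 t ↔ (t \ s).Finite := by
  rw [mem_inf_principal', mem_cofinite]
  simp [Set.compl_union, Set.sdiff_eq]

/-- If Y ⊆ X, the map is injective on 𝒞_{X'}(Y) and reaches all of 𝒞_X(Y) except possibly the
finitely many components meeting X'. If Y ⊈ X, every component in the infinite set 𝒞_{X'}(Y) has a
neighbour in Y \ X, hence lies in C_X(Y), and the map is constant there. -/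
theorem map_gammaNhds {X X' : Finset V} (h : X ⊆ X') (ξ : GammaAt G X') :
    map (fun C => C.hom (Finset.coe_subset.mpr h)) (gammaNhds ξ) ≤ gammaNhds (bonding G h ξ) ∧
      gammaNhds (bonding G h ξ) ≤
        map (fun C => C.hom (Finset.coe_subset.mpr h)) (gammaNhds ξ) := by
  rcases ξ with C | ⟨Y, hY, hYX⟩
  · exact ⟨le_rfl, le_rfl⟩
  by_cases h1 : Y ⊆ X
  · simp only [bonding, h1, dite_true, gammaNhds]
    constructor
    · intro 𝒟 h𝒟
      rw [mem_cofinite_inf_principal] at h𝒟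
      rw [mem_map, mem_cofinite_inf_principal]
      refine Set.Finite.of_finite_image (h𝒟.subset ?_)
        ((injOn_hom_compsWithNbhd h h1).mono Set.sdiff_subset)
      rintro _ ⟨C, hC, rfl⟩
      exact ⟨hom_mem_compsWithNbhd h h1 hC.1, hC.2⟩
    · intro 𝒟 h𝒟
      rw [mem_map, mem_cofinite_inf_principal] at h𝒟
      rw [mem_cofinite_inf_principal]
      refine ((h𝒟.image fun C => C.hom (Finset.coe_subset.mpr h)).union
        (finite_setOf_meets _ X')).subset ?_
      rintro C ⟨hC, hC𝒟⟩
      by_cases hm : ∃ v ∈ X', v ∈ C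
      · exact Or.inr hm
      · push Not at hm
        obtain ⟨D, rfl, hD⟩ := exists_hom_eq_of_disjoint (Finset.coe_subset.mpr h) C
          (fun v hv hvX => hm v hvX hv)
        refine Or.inl ⟨D, ⟨?_, hC𝒟⟩, rfl⟩
        change nbhd G _ = _
        rw [hD]
        exact hC
  · have hconst : ∀ C ∈ compsWithNbhd G X' Y,
        C.hom (Finset.coe_subset.mpr h) = critComp hY h1 := by
      intro C hC
      obtain ⟨y, hy, hyX⟩ := Finset.not_subset.mp h1
      have hyC : y ∈ nbhd G (C : Set V) := by rw [hC]; exact hy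
      obtain ⟨-, u, hu, huy⟩ := hyC
      exact eq_critComp hY h1 ⟨y, hy,
        SimpleGraph.ComponentCompl.mem_of_adj u y (mem_hom _ hu) hyX huy⟩
    have hinf : (compsWithNbhd G X' Y).Infinite := by
      refine (Set.Infinite.sdiff hY (finite_setOf_meets _ X')).mono ?_ |>.of_image
        (fun C : G.ComponentCompl X' => C.hom (Finset.coe_subset.mpr hYX))
      rintro C ⟨hC, hm⟩
      obtain ⟨D, rfl, hD⟩ := exists_hom_eq_of_disjoint (Finset.coe_subset.mpr hYX) C
        (fun v hv hvX => hm ⟨v, hvX, hv⟩)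
      refine ⟨D, ?_, rfl⟩
      change nbhd G _ = _
      rw [hD]
      exact hC
    simp only [bonding, h1, dite_false, gammaNhds]
    constructor
    · intro 𝒟 h𝒟
      rw [mem_map, mem_cofinite_inf_principal]
      refine Set.Finite.subset Set.finite_empty ?_
      rintro C ⟨hC, hC𝒟⟩
      exact hC𝒟 (by rw [Set.mem_preimage, hconst C hC]; exact h𝒟)
    · intro 𝒟 h𝒟
      rw [mem_map, mem_cofinite_inf_principal] at h𝒟
      obtain ⟨C, hC, hC'⟩ := (hinf.sdiff h𝒟).nonempty
      have : C.hom (Finset.coe_subset.mpr h) ∈ 𝒟 := by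
        by_contra hn
        exact hC' ⟨hC, hn⟩
      rwa [hconst C hC] at this

theorem gammaNhds_bonding {X X' : Finset V} (h : X ⊆ X') (ξ : GammaAt G X') :
    gammaNhds (bonding G h ξ) =
      map (fun C => C.hom (Finset.coe_subset.mpr h)) (gammaNhds ξ) :=
  le_antisymm (map_gammaNhds h ξ).2 (map_gammaNhds h ξ).1

theorem gammaNhds_neBot {X : Finset V} (ξ : GammaAt G X) : (gammaNhds ξ).NeBot := by
  rcases ξ with C | ⟨Y, hY, hYX⟩
  · exact pure_neBot
  -- At Y itself the filter is proper by the definition of criticality, and it is the push-forward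
  -- of the filter at X.
  · have h : (gammaNhds (bonding G hYX (Sum.inr ⟨Y, hY, hYX⟩))).NeBot := by
      simp only [bonding, Finset.Subset.refl, dite_true, gammaNhds]
      exact Set.Infinite.cofinite_inf_principal_neBot hY
    rw [gammaNhds_bonding] at h
    exact (map_neBot_iff _).mp h

theorem IsCritical.infinite_compsWithNbhd {X Y : Finset V} (hY : IsCritical G Y) (h : Y ⊆ X) :
    (compsWithNbhd G X Y).Infinite :=
  cofinite_inf_principal_neBot_iff.mp (gammaNhds_neBot (Sum.inr ⟨Y, hY, h⟩ : GammaAt G X))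

/-- Principal filters decide every set, so only the cofinite filters on the sets 𝒞_X(Y) impose a
condition. In this form the closure properties of tame sets become formal. -/
theorem isTame_iff {X : Finset V} {𝒞 : Set (G.ComponentCompl X)} :
    IsTame 𝒞 ↔ ∀ ξ : GammaAt G X, 𝒞 ∈ gammaNhds ξ ∨ 𝒞ᶜ ∈ gammaNhds ξ := by
  have key : ∀ Y : Finset V, ¬ ((compsWithNbhd G X Y ∩ 𝒞).Infinite ∧
      (compsWithNbhd G X Y ∩ 𝒞ᶜ).Infinite) ↔
      𝒞 ∈ cofinite ⊓ 𝓟 (compsWithNbhd G X Y) ∨ 𝒞ᶜ ∈ cofinite ⊓ 𝓟 (compsWithNbhd G X Y) := by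
    intro Y
    simp only [mem_cofinite_inf_principal, Set.sdiff_eq, compl_compl, not_and_or,
      Set.not_infinite]
    exact or_comm
  constructor
  · rintro h (C | Y)
    · exact em _
    · exact (key Y.1).mp (h Y.1 Y.2.1 Y.2.2)
  · exact fun h Y hY hYX => (key Y).mpr (h (Sum.inr ⟨Y, hY, hYX⟩))

theorem IsTame.compl {X : Finset V} {𝒞 : Set (G.ComponentCompl X)} (h : IsTame 𝒞) :
    IsTame 𝒞ᶜ := by
  rw [isTame_iff] at h ⊢
  intro ξ
  rw [compl_compl]
  exact (h ξ).symm

theorem IsTame.inter {X : Finset V} {𝒞 𝒟 : Set (G.ComponentCompl X)} (h : IsTame 𝒞)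
    (h' : IsTame 𝒟) : IsTame (𝒞 ∩ 𝒟) := by
  rw [isTame_iff] at h h' ⊢
  intro ξ
  rw [Set.compl_inter]
  rcases h ξ with h | h
  · rcases h' ξ with h' | h'
    · exact Or.inl (inter_mem h h')
    · exact Or.inr (mem_of_superset h' Set.subset_union_right)
  · exact Or.inr (mem_of_superset h Set.subset_union_left)

theorem IsTame.union {X : Finset V} {𝒞 𝒟 : Set (G.ComponentCompl X)} (h : IsTame 𝒞)
    (h' : IsTame 𝒟) : IsTame (𝒞 ∪ 𝒟) := by
  have := (h.compl.inter h'.compl).compl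
  rwa [← Set.compl_union, compl_compl] at this

theorem isTame_of_finite {X : Finset V} {𝒞 : Set (G.ComponentCompl X)} (h : 𝒞.Finite) :
    IsTame 𝒞 :=
  fun _ _ _ h' => h'.1 (h.subset Set.inter_subset_right)

theorem isTame_of_subset_compsWithNbhd {X Y : Finset V} {𝒞 : Set (G.ComponentCompl X)}
    (h : 𝒞 ⊆ compsWithNbhd G X Y) (hfin : (compsWithNbhd G X Y \ 𝒞).Finite) : IsTame 𝒞 := by
  rintro Z - - ⟨h1, h2⟩
  obtain ⟨C, hCZ, hC⟩ := h1.nonempty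
  have e : (Z : Set V) = Y := hCZ.symm.trans (h hC)
  obtain rfl : Z = Y := Finset.coe_injective e
  exact h2 hfin

theorem IsTame.preimage_hom {X X' : Finset V} (h : X ⊆ X') {𝒞 : Set (G.ComponentCompl X)}
    (h𝒞 : IsTame 𝒞) :
    IsTame ((fun C : G.ComponentCompl X' => C.hom (Finset.coe_subset.mpr h)) ⁻¹' 𝒞) := by
  rw [isTame_iff] at h𝒞 ⊢
  intro ξ
  have := h𝒞 (bonding G h ξ)
  rwa [gammaNhds_bonding] at this

theorem mem_gammaFilter {X : Finset V} {ξ : GammaAt G X} {𝒟 : Set (G.ComponentCompl X)} :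
    𝒟 ∈ gammaFilter ξ ↔ IsTame 𝒟 ∧ 𝒟 ∈ gammaNhds ξ := by
  rcases ξ with C | Y
  · simp [gammaFilter, gammaNhds]
  · simp only [gammaFilter, gammaNhds, Set.mem_ofPred_eq, mem_cofinite_inf_principal]
    refine and_congr_right fun _ => ⟨?_, fun h => ?_⟩
    · rintro ⟨ℰ, -, hfin, hℰ⟩
      exact hfin.subset (Set.sdiff_subset_sdiff_right hℰ)
    · exact ⟨compsWithNbhd G X Y.1 ∩ 𝒟, Set.inter_subset_left, by simpa using h,
        Set.inter_subset_right⟩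

/-- The sets {C} and 𝒞_X(Y) are themselves tame and distinguish the filters, because 𝒞_X(Y) is
infinite and different Y have disjoint classes. -/
theorem gammaFilter_injective (X : Finset V) :
    Function.Injective (gammaFilter : GammaAt G X → Set (Set (G.ComponentCompl X))) := by
  have key : ∀ (C : G.ComponentCompl X) (Y : CritSub G X),
      gammaFilter (Sum.inl C : GammaAt G X) ≠ gammaFilter (Sum.inr Y) := by
    intro C Y h
    have h1 : {C} ∈ gammaFilter (Sum.inl C : GammaAt G X) :=
      ⟨isTame_of_finite (Set.finite_singleton C), subset_rfl⟩
    rw [h, mem_gammaFilter] at h1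
    have h2 := mem_cofinite_inf_principal.mp h1.2
    exact (Y.2.1.infinite_compsWithNbhd Y.2.2).sdiff (Set.finite_singleton C) h2
  rintro (C | Y) (D | Z) h
  · have h1 : {C} ∈ gammaFilter (Sum.inl C : GammaAt G X) :=
      ⟨isTame_of_finite (Set.finite_singleton C), subset_rfl⟩
    rw [h] at h1
    exact congrArg Sum.inl (Set.singleton_subset_singleton.mp h1.2).symm
  · exact absurd h (key C Z)
  · exact absurd h.symm (key D Y)
  · have h1 : compsWithNbhd G X Y.1 ∈ gammaFilter (Sum.inr Y : GammaAt G X) :=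
      mem_gammaFilter.mpr ⟨isTame_of_subset_compsWithNbhd subset_rfl (by simp),
        mem_cofinite_inf_principal.mpr (by simp)⟩
    rw [h, mem_gammaFilter] at h1
    have h2 := mem_cofinite_inf_principal.mp h1.2
    obtain ⟨C, hCZ, hC⟩ := ((Z.2.1.infinite_compsWithNbhd Z.2.2).sdiff h2).nonempty
    have hCY : C ∈ compsWithNbhd G X Y.1 := by
      by_contra hn
      exact hC ⟨hCZ, hn⟩
    have e : (Y.1 : Set V) = Z.1 := hCY.symm.trans hCZ
    exact congrArg Sum.inr (Subtype.ext (Finset.coe_injective e))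

/-! ### Separations `s_{X → 𝒞}` -/

theorem mem_verts {X : Finset V} {𝒞 : Set (G.ComponentCompl X)} {v : V} :
    v ∈ verts 𝒞 ↔ ∃ C ∈ 𝒞, v ∈ C := by
  simp [verts]

theorem mem_verts_of_mem {X : Finset V} {𝒞 : Set (G.ComponentCompl X)} {C : G.ComponentCompl X}
    {v : V} (hv : v ∈ C) : v ∈ verts 𝒞 ↔ C ∈ 𝒞 := by
  rw [mem_verts]
  exact ⟨fun ⟨D, hD, hvD⟩ => eq_of_mem_of_mem hvD hv ▸ hD, fun h => ⟨C, h, hv⟩⟩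

theorem verts_mono {X : Finset V} {𝒞 𝒟 : Set (G.ComponentCompl X)} (h : 𝒞 ⊆ 𝒟) :
    verts 𝒞 ⊆ verts 𝒟 :=
  Set.biUnion_subset_biUnion_left h

theorem exists_mem_component {X : Finset V} {v : V} (hv : v ∉ X) :
    ∃ C : G.ComponentCompl X, v ∈ C :=
  ⟨_, G.componentComplMk_mem (K := (X : Set V)) hv⟩

theorem mem_verts_preimage_hom {X X' : Finset V} (h : X ⊆ X') {𝒞 : Set (G.ComponentCompl X)}
    {v : V} :
    v ∈ verts ((fun C : G.ComponentCompl X' => C.hom (Finset.coe_subset.mpr h)) ⁻¹' 𝒞) ↔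
      v ∈ verts 𝒞 ∧ v ∉ X' := by
  by_cases hv : v ∈ X'
  · simpa [hv] using fun h => notMem_of_mem_verts h hv
  · obtain ⟨C, hC⟩ := exists_mem_component (G := G) hv
    rw [mem_verts_of_mem hC, mem_verts_of_mem (mem_hom (Finset.coe_subset.mpr h) hC)]
    simp [hv]

theorem sepTo_inter {X : Finset V} (𝒞 : Set (G.ComponentCompl X)) :
    (sepTo X 𝒞).small ∩ (sepTo X 𝒞).big = X := by
  ext v
  have := @notMem_of_mem_verts V G X 𝒞 v
  simp only [sepTo, Set.mem_inter_iff, Set.mem_compl_iff, Set.mem_union, Finset.mem_coe]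
  tauto

theorem verts_injective (X : Finset V) :
    Function.Injective (verts : Set (G.ComponentCompl X) → Set V) := by
  intro 𝒞 𝒟 h
  ext C
  obtain ⟨v, hv⟩ := C.nonempty
  rw [← mem_verts_of_mem hv, h, mem_verts_of_mem hv]

theorem sepTo_inj {X : Finset V} {𝒞 𝒟 : Set (G.ComponentCompl X)} :
    sepTo X 𝒞 = sepTo X 𝒟 ↔ 𝒞 = 𝒟 :=
  ⟨fun h => verts_injective X (compl_injective (congrArg Separation.small h)), fun h => h ▸ rfl⟩

theorem eq_of_sepTo_eq {X X' : Finset V} {𝒞 : Set (G.ComponentCompl X)}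
    {𝒟 : Set (G.ComponentCompl X')} (h : sepTo X 𝒞 = sepTo X' 𝒟) : X = X' := by
  have := sepTo_inter 𝒞
  rw [h, sepTo_inter] at this
  exact (Finset.coe_injective this).symm

theorem IsTame.sepTo_mem {X : Finset V} {𝒞 : Set (G.ComponentCompl X)} (h : IsTame 𝒞) :
    sepTo X 𝒞 ∈ tameSeps G :=
  ⟨X, 𝒞, h, h.compl, rfl⟩

theorem sepTo_le_sepTo {X : Finset V} {𝒞 𝒟 : Set (G.ComponentCompl X)} (h : 𝒟 ⊆ 𝒞) :
    sepTo X 𝒞 ≤ sepTo X 𝒟 :=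
  ⟨Set.compl_subset_compl.mpr (verts_mono h), Set.union_subset_union_right _ (verts_mono h)⟩

/-! ### Tangles of tame separations -/

theorem isStar_of_pairwise {σ : Set (Separation G)}
    (h : σ.Pairwise fun s t => s ≤ t.swap) : IsStar σ :=
  fun _ hs _ ht hst => h hs ht hst

theorem Separation.le_swap_symm {s t : Separation G} (h : s ≤ t.swap) : t ≤ s.swap :=
  ⟨h.2, h.1⟩

section Tangle

variable {τ : Set (Separation G)} (hτ : τ ∈ Theta G)
include hτ

theorem starInterior_infinite {σ : Set (Separation G)} (hσ : σ ⊆ τ) (hfin : σ.Finite)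
    (hstar : IsStar σ) : (starInterior σ).Infinite :=
  fun h => hτ.avoids σ hσ ⟨hσ.trans hτ.orientation.1, hstar, hfin, h⟩

theorem mem_or_swap_mem {s : Separation G} (hs : s ∈ tameSeps G) : s ∈ τ ∨ s.swap ∈ τ := by
  obtain ⟨t, ⟨rfl | rfl, ht⟩, -⟩ := hτ.orientation.2 s hs
  · exact Or.inl ht
  · exact Or.inr ht

/-- The case s = t is included: then the star is a singleton, and the big side itself is infinite.
-/
theorem inter_big_infinite {s t : Separation G} (hs : s ∈ τ) (ht : t ∈ τ)
    (hst : s ≠ t → s ≤ t.swap) : (s.big ∩ t.big).Infinite := by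
  have h := starInterior_infinite hτ (σ := {s, t}) (by
    rintro _ (rfl | rfl) <;> assumption) (by simp) (isStar_of_pairwise (by
    rw [Set.pairwise_pair]
    exact fun hne => ⟨hst hne, Separation.le_swap_symm (hst hne)⟩))
  simpa [starInterior] using h

theorem mem_of_le {s t : Separation G} (hs : s ∈ τ) (ht : t ∈ tameSeps G) (hts : t ≤ s) :
    t ∈ τ := by
  rcases eq_or_ne t s with rfl | hne
  · exact hs
  refine (mem_or_swap_mem hτ ht).resolve_right fun h => ?_
  -- Consistency speaks only of distinct elements. If s is the inverse of t, its big side lies in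
  -- the finite separator, so the singleton star {s} is already forbidden.
  rcases eq_or_ne t.swap s with rfl | hne'
  · refine inter_big_infinite hτ hs hs (fun h => absurd rfl h) (t.finite_inter.subset ?_)
    rw [Set.inter_self]
    exact fun v hv => ⟨hv, hts.1 hv⟩
  · exact hτ.consistent _ h _ hs hne' (lt_of_le_of_ne hts hne)

/-! ### The filters F(τ, X) as ultrafilters of tame sets -/

variable {X : Finset V} {𝒞 𝒟 : Set (G.ComponentCompl X)}

theorem tangleFilter_mono (h : 𝒞 ∈ tangleFilter τ X) (h𝒟 : IsTame 𝒟) (h𝒞𝒟 : 𝒞 ⊆ 𝒟) :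
    𝒟 ∈ tangleFilter τ X :=
  ⟨h𝒟, mem_of_le hτ h.2 h𝒟.sepTo_mem (sepTo_le_sepTo h𝒞𝒟)⟩

theorem mem_tangleFilter_or_compl_mem (h𝒞 : IsTame 𝒞) :
    𝒞 ∈ tangleFilter τ X ∨ 𝒞ᶜ ∈ tangleFilter τ X := by
  rcases mem_or_swap_mem hτ h𝒞.sepTo_mem with h | h
  · exact Or.inl ⟨h𝒞, h⟩
  · exact Or.inr ⟨h𝒞.compl, swap_sepTo X 𝒞 ▸ h⟩

theorem empty_notMem_tangleFilter : ∅ ∉ tangleFilter τ X := by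
  intro h
  refine inter_big_infinite hτ h.2 h.2 (fun h => absurd rfl h) ?_
  simp [sepTo, verts]

/-- Were (𝒞 ∩ 𝒟)ᶜ chosen, then 𝒞, 𝒟 ∪ 𝒞ᶜ and (𝒞 ∩ 𝒟)ᶜ would have disjoint complements, which makes
their separations a star, and empty intersection, which makes its interior X. Enlarging 𝒟 to 𝒟 ∪ 𝒞ᶜ
is what makes the complements disjoint. -/
theorem inter_mem_tangleFilter (h𝒞 : 𝒞 ∈ tangleFilter τ X) (h𝒟 : 𝒟 ∈ tangleFilter τ X) :
    𝒞 ∩ 𝒟 ∈ tangleFilter τ X := by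
  refine (mem_tangleFilter_or_compl_mem hτ (h𝒞.1.inter h𝒟.1)).resolve_right fun h => ?_
  have h' : 𝒟 ∪ 𝒞ᶜ ∈ tangleFilter τ X :=
    tangleFilter_mono hτ h𝒟 (h𝒟.1.union h𝒞.1.compl) Set.subset_union_left
  refine starInterior_infinite hτ
    (σ := {sepTo X 𝒞, sepTo X (𝒟 ∪ 𝒞ᶜ), sepTo X (𝒞 ∩ 𝒟)ᶜ}) ?_ (by simp) ?_ ?_
  · rintro _ (rfl | rfl | rfl)
    exacts [h𝒞.2, h'.2, h.2]
  · rintro _ (rfl | rfl | rfl) _ (rfl | rfl | rfl) hne <;>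
    first
    | exact absurd rfl hne
    | rw [swap_sepTo]
      refine sepTo_le_sepTo fun C => ?_
      simp only [Set.mem_compl_iff, Set.mem_union, Set.mem_inter_iff]
      tauto
  · refine X.finite_toSet.subset fun v hv => ?_
    by_contra hvX
    obtain ⟨C, hC⟩ := exists_mem_component (G := G) hvX
    simp only [starInterior, Set.mem_insert_iff, Set.mem_singleton_iff, Set.iInter_iInter_eq_or_left,
      Set.iInter_iInter_eq_left, sepTo, Set.mem_inter_iff, Set.mem_union, mem_verts_of_mem hC,
      Set.mem_compl_iff] at hv
    tauto

theorem compl_mem_tangleFilter_iff (h𝒞 : IsTame 𝒞) :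
    𝒞ᶜ ∈ tangleFilter τ X ↔ 𝒞 ∉ tangleFilter τ X := by
  refine ⟨fun h h' => empty_notMem_tangleFilter hτ (X := X) ?_,
    (mem_tangleFilter_or_compl_mem hτ h𝒞).resolve_left⟩
  simpa using inter_mem_tangleFilter hτ h' h

theorem exists_singleton_mem_tangleFilter (hfin : 𝒞.Finite) (h : 𝒞 ∈ tangleFilter τ X) :
    ∃ C, {C} ∈ tangleFilter τ X := by
  induction 𝒞, hfin using Set.Finite.induction_on with
  | empty => exact absurd h (empty_notMem_tangleFilter hτ)
  | @insert C 𝒟 _ h𝒟 ih =>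
    rcases mem_tangleFilter_or_compl_mem hτ (isTame_of_finite (Set.finite_singleton C)) with hC | hC
    · exact ⟨C, hC⟩
    · refine ih (tangleFilter_mono hτ (inter_mem_tangleFilter hτ h hC) (isTame_of_finite h𝒟) ?_)
      rintro D ⟨rfl | hD, hDC⟩
      · exact absurd rfl hDC
      · exact hD

theorem exists_compsWithNbhd_mem_tangleFilter (X : Finset V) :
    ∃ Y ⊆ X, compsWithNbhd G X Y ∈ tangleFilter τ X := by
  classical
  have htame : ∀ Y, IsTame (compsWithNbhd G X Y) := fun Y =>
    isTame_of_subset_compsWithNbhd subset_rfl (by simp)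
  by_contra! hcon
  have key : ∀ T ⊆ X.powerset, (⋃ Y ∈ T, compsWithNbhd G X Y)ᶜ ∈ tangleFilter τ X := by
    intro T
    induction T using Finset.induction_on with
    | empty =>
      intro _
      simp only [Finset.notMem_empty, Set.iUnion_of_empty, Set.iUnion_empty]
      exact (compl_mem_tangleFilter_iff hτ (isTame_of_finite Set.finite_empty)).mpr
        (empty_notMem_tangleFilter hτ)
    | insert Y T _ ih =>
      intro hT
      rw [Finset.insert_subset_iff, Finset.mem_powerset] at hT
      rw [Finset.set_biUnion_insert, Set.compl_union]
      exact inter_mem_tangleFilter hτ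
        ((compl_mem_tangleFilter_iff hτ (htame Y)).mpr (hcon Y hT.1)) (ih hT.2)
  refine empty_notMem_tangleFilter hτ (X := X) ?_
  have hempty : (⋃ Y ∈ X.powerset, compsWithNbhd G X Y)ᶜ = ∅ := by
    refine Set.eq_empty_of_forall_notMem fun C hC => hC ?_
    obtain ⟨Y, hY, hCY⟩ := exists_mem_compsWithNbhd C
    simp only [Set.mem_iUnion]
    exact ⟨Y, Finset.mem_powerset.mpr hY, hCY⟩
  exact hempty ▸ key X.powerset subset_rfl

/-- Both sides contain exactly one of 𝒞 and 𝒞ᶜ for every tame 𝒞, so inclusion forces equality. -/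
theorem tangleFilter_eq_gammaFilter_of_subset {ξ : GammaAt G X}
    (h : gammaFilter ξ ⊆ tangleFilter τ X) : tangleFilter τ X = gammaFilter ξ := by
  refine Set.Subset.antisymm (fun 𝒞 h𝒞 => mem_gammaFilter.mpr ⟨h𝒞.1, ?_⟩) h
  refine (isTame_iff.mp h𝒞.1 ξ).resolve_right fun h' => ?_
  exact (compl_mem_tangleFilter_iff hτ h𝒞.1).mp
    (h (mem_gammaFilter.mpr ⟨h𝒞.1.compl, h'⟩)) h𝒞

theorem exists_tangleFilter_eq_gammaFilter (X : Finset V) :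
    ∃ ξ : GammaAt G X, tangleFilter τ X = gammaFilter ξ := by
  by_cases hfin : ∃ 𝒞 : Set (G.ComponentCompl X), 𝒞.Finite ∧ 𝒞 ∈ tangleFilter τ X
  · obtain ⟨𝒞, h𝒞, h⟩ := hfin
    obtain ⟨C, hC⟩ := exists_singleton_mem_tangleFilter hτ h𝒞 h
    exact ⟨Sum.inl C, tangleFilter_eq_gammaFilter_of_subset hτ
      fun 𝒟 h𝒟 => tangleFilter_mono hτ hC h𝒟.1 h𝒟.2⟩
  · push Not at hfin
    obtain ⟨Y, hYX, hY⟩ := exists_compsWithNbhd_mem_tangleFilter hτ X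
    have hcrit : IsCritical G Y := isCritical_of_infinite hYX fun h => hfin _ h hY
    refine ⟨Sum.inr ⟨Y, hcrit, hYX⟩, tangleFilter_eq_gammaFilter_of_subset hτ fun 𝒟 h𝒟 => ?_⟩
    rw [mem_gammaFilter] at h𝒟
    by_contra hn
    exact hfin _ (mem_cofinite_inf_principal.mp h𝒟.2) (inter_mem_tangleFilter hτ hY
      ((compl_mem_tangleFilter_iff hτ h𝒟.1).mpr hn))

/-- Passing directly from X to X' need not give a star, since X ∪ V[𝒞] may miss part of X'. So first
enlarge X to Z = X' \ V[𝒞]: this keeps the small side and enlarges the big one, giving a smaller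
separation, still in τ. Together with the complementary choice at X' it would form a star with
interior in X'. -/
theorem preimage_hom_mem_tangleFilter {X' : Finset V} (h : X ⊆ X') (h𝒞 : 𝒞 ∈ tangleFilter τ X) :
    (fun C : G.ComponentCompl X' => C.hom (Finset.coe_subset.mpr h)) ⁻¹' 𝒞 ∈
      tangleFilter τ X' := by
  classical
  obtain ⟨Z, hZ⟩ : ∃ Z : Finset V, ∀ v, v ∈ Z ↔ v ∈ X' ∧ v ∉ verts 𝒞 :=
    ⟨X'.filter (· ∉ verts 𝒞), fun v => by simp⟩
  have hXZ : X ⊆ Z := fun v hv => (hZ v).mpr ⟨h hv, fun hv' => notMem_of_mem_verts hv' hv⟩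
  set 𝒞Z := (fun C : G.ComponentCompl Z => C.hom (Finset.coe_subset.mpr hXZ)) ⁻¹' 𝒞
  have hvZ : verts 𝒞Z = verts 𝒞 := by
    ext v
    rw [mem_verts_preimage_hom hXZ, hZ]
    tauto
  have hmemZ : sepTo Z 𝒞Z ∈ τ := by
    refine mem_of_le hτ h𝒞.2 (h𝒞.1.preimage_hom hXZ).sepTo_mem ⟨?_, ?_⟩
    · exact (congrArg compl hvZ).subset
    · change (X : Set V) ∪ verts 𝒞 ⊆ Z ∪ verts 𝒞Z
      rw [hvZ]
      exact Set.union_subset_union_left _ (Finset.coe_subset.mpr hXZ)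
  refine (mem_tangleFilter_or_compl_mem hτ (h𝒞.1.preimage_hom h)).resolve_right fun h' => ?_
  have hτ' := h'.2
  rw [← swap_sepTo] at hτ'
  refine inter_big_infinite hτ hmemZ hτ' (fun _ => ⟨fun v hv => ?_, fun v hv => ?_⟩)
    (X'.finite_toSet.subset fun v hv => ?_)
  · change v ∉ verts 𝒞Z at hv
    change v ∉ verts _
    rw [mem_verts_preimage_hom h]
    rw [hvZ] at hv
    tauto
  · change v ∈ (X' : Set V) ∪ verts _ at hv
    change v ∈ (Z : Set V) ∪ verts 𝒞Z
    rw [Set.mem_union, mem_verts_preimage_hom h] at hv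
    rw [hvZ, Set.mem_union, Finset.mem_coe, hZ]
    rw [Finset.mem_coe] at hv
    tauto
  · obtain ⟨h1, h2⟩ := hv
    change v ∈ (Z : Set V) ∪ verts 𝒞Z at h1
    change v ∉ verts _ at h2
    rw [mem_verts_preimage_hom h] at h2
    rw [hvZ, Set.mem_union, Finset.mem_coe, hZ] at h1
    rw [Finset.mem_coe]
    tauto

theorem bonding_eq_of_tangleFilter_eq {X' : Finset V} (h : X ⊆ X') {ξ : GammaAt G X}
    {ξ' : GammaAt G X'} (hξ : tangleFilter τ X = gammaFilter ξ)
    (hξ' : tangleFilter τ X' = gammaFilter ξ') : bonding G h ξ' = ξ := by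
  refine gammaFilter_injective X ?_
  rw [← hξ]
  refine (tangleFilter_eq_gammaFilter_of_subset hτ fun 𝒟 h𝒟 => ?_).symm
  rw [mem_gammaFilter, gammaNhds_bonding, mem_map] at h𝒟
  have h' := mem_gammaFilter.mpr ⟨h𝒟.1.preimage_hom h, h𝒟.2⟩
  rw [← hξ'] at h'
  by_contra hn
  exact (compl_mem_tangleFilter_iff hτ (h𝒟.1.preimage_hom h)).mp
    (preimage_hom_mem_tangleFilter hτ h ((compl_mem_tangleFilter_iff hτ h𝒟.1).mpr hn)) h'

theorem subset_of_tangleFilter_eq {τ' : Set (Separation G)}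
    (h : ∀ X, tangleFilter τ X = tangleFilter τ' X) : τ ⊆ τ' := by
  intro s hs
  obtain ⟨X, 𝒞, h𝒞, -, rfl⟩ := hτ.orientation.1 hs
  exact ((h X).subset ⟨h𝒞, hs⟩).2

end Tangle

theorem Theta.ext {τ τ' : Set (Separation G)} (hτ : τ ∈ Theta G) (hτ' : τ' ∈ Theta G)
    (h : ∀ X, tangleFilter τ X = tangleFilter τ' X) : τ = τ' :=
  Set.Subset.antisymm (subset_of_tangleFilter_eq hτ h)
    (subset_of_tangleFilter_eq hτ' fun X => (h X).symm)

/-! ### The tangle defined by an element of `Γ` -/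

/-- The set of the separations `s_{X → 𝒞}` with `𝒞` in the filter given by the coordinate of `γ`
at `X`. -/
def gammaTangle (γ : Gamma G) : Set (Separation G) :=
  {s | ∃ (X : Finset V) (𝒞 : Set (G.ComponentCompl X)), 𝒞 ∈ gammaFilter (γ.1 X) ∧ s = sepTo X 𝒞}

/-- X and 𝒞 can be read off from the separation, X being the intersection of its sides, so different
coordinates of γ never compete. -/
theorem sepTo_mem_gammaTangle {γ : Gamma G} {X : Finset V} {𝒞 : Set (G.ComponentCompl X)} :
    sepTo X 𝒞 ∈ gammaTangle γ ↔ 𝒞 ∈ gammaFilter (γ.1 X) := by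
  refine ⟨?_, fun h => ⟨X, 𝒞, h, rfl⟩⟩
  rintro ⟨X', 𝒟, h, e⟩
  obtain rfl := eq_of_sepTo_eq e
  rwa [sepTo_inj.mp e]

theorem tangleFilter_gammaTangle (γ : Gamma G) (X : Finset V) :
    tangleFilter (gammaTangle γ) X = gammaFilter (γ.1 X) := by
  ext 𝒞
  exact ⟨fun h => sepTo_mem_gammaTangle.mp h.2,
    fun h => ⟨(mem_gammaFilter.mp h).1, sepTo_mem_gammaTangle.mpr h⟩⟩

theorem exists_forall_mem_big {γ : Gamma G} {σ : Set (Separation G)} (hfin : σ.Finite)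
    (hσ : σ ⊆ gammaTangle γ) (Z : Finset V) : ∃ v ∉ Z, ∀ s ∈ σ, v ∈ s.big := by
  classical
  have hσ' : ∀ s ∈ σ, ∃ (X : Finset V) (𝒞 : Set (G.ComponentCompl X)),
      𝒞 ∈ gammaFilter (γ.1 X) ∧ s = sepTo X 𝒞 := fun s hs => hσ hs
  choose! X hσX using hσ'
  obtain ⟨W, hW⟩ : ∃ W : Finset V, W = Z ∪ hfin.toFinset.biUnion X := ⟨_, rfl⟩
  have hX : ∀ s ∈ σ, X s ⊆ W := fun s hs => by
    rw [hW]
    exact (Finset.subset_biUnion_of_mem X (hfin.mem_toFinset.mpr hs)).trans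
      Finset.subset_union_right
  have hmem : ∀ s ∈ σ, {C : G.ComponentCompl W | ∀ v ∈ C, v ∈ s.big} ∈ gammaNhds (γ.1 W) := by
    intro s hsσ
    obtain ⟨𝒞, h𝒞, hs⟩ := hσX s hsσ
    have h1 := (mem_gammaFilter.mp h𝒞).2
    rw [← γ.2 (X s) W (hX s hsσ), gammaNhds_bonding, mem_map] at h1
    refine mem_of_superset h1 fun C hC v hv => ?_
    rw [hs]
    exact Or.inr ((mem_verts_of_mem (mem_hom _ hv)).mpr hC)
  have := gammaNhds_neBot (γ.1 W)
  obtain ⟨C, hC⟩ := nonempty_of_mem ((biInter_mem hfin).mpr hmem)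
  obtain ⟨v, hv⟩ := C.nonempty
  refine ⟨v, fun hvZ => SimpleGraph.ComponentCompl.notMem_of_mem hv ?_, fun s hs => ?_⟩
  · rw [Finset.mem_coe, hW]
    exact Finset.mem_union_left _ hvZ
  · exact Set.mem_iInter₂.mp hC s hs v hv

theorem gammaTangle_mem_Theta (γ : Gamma G) : gammaTangle γ ∈ Theta G := by
  have hsub : gammaTangle γ ⊆ tameSeps G := by
    rintro _ ⟨X, 𝒞, h, rfl⟩
    exact (mem_gammaFilter.mp h).1.sepTo_mem
  refine ⟨⟨hsub, ?_⟩, ?_, ?_⟩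
  · rintro _ ⟨X, 𝒞, h𝒞, -, rfl⟩
    have := gammaNhds_neBot (γ.1 X)
    rw [swap_sepTo]
    rcases isTame_iff.mp h𝒞 (γ.1 X) with h | h
    · refine ⟨_, ⟨Or.inl rfl, sepTo_mem_gammaTangle.mpr (mem_gammaFilter.mpr ⟨h𝒞, h⟩)⟩, ?_⟩
      rintro _ ⟨rfl | rfl, ht⟩
      · rfl
      · exact absurd (mem_gammaFilter.mp (sepTo_mem_gammaTangle.mp ht)).2
          (compl_notMem h)
    · refine ⟨_, ⟨Or.inr rfl,
        sepTo_mem_gammaTangle.mpr (mem_gammaFilter.mpr ⟨h𝒞.compl, h⟩)⟩, ?_⟩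
      rintro _ ⟨rfl | rfl, ht⟩
      · exact absurd (mem_gammaFilter.mp (sepTo_mem_gammaTangle.mp ht)).2
          (fun h' => compl_notMem h' h)
      · rfl
  · intro s hs t ht _ hlt
    obtain ⟨Z, hZ⟩ := s.finite_inter.exists_finset_coe
    obtain ⟨v, hvZ, hv⟩ := exists_forall_mem_big (σ := {s, t}) (γ := γ) (by simp)
      (by rintro _ (rfl | rfl) <;> assumption) Z
    refine hvZ ?_
    rw [← Finset.mem_coe, hZ]
    exact ⟨hlt.le.2 (hv t (by simp)), hv s (by simp)⟩
  · rintro σ hσ ⟨-, -, hfin, hint⟩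
    obtain ⟨Z, hZ⟩ := hint.exists_finset_coe
    obtain ⟨v, hvZ, hv⟩ := exists_forall_mem_big hfin hσ Z
    refine hvZ ?_
    rw [← Finset.mem_coe, hZ]
    exact Set.mem_iInter₂.mpr hv

/-- The element of `Γ` whose coordinate at `X` gives the filter `F(τ, X)`. -/
noncomputable def thetaToGamma (τ : Theta G) : Gamma G :=
  ⟨fun X => (exists_tangleFilter_eq_gammaFilter τ.2 X).choose, fun X X' h =>
    bonding_eq_of_tangleFilter_eq τ.2 h (exists_tangleFilter_eq_gammaFilter τ.2 X).choose_spec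
      (exists_tangleFilter_eq_gammaFilter τ.2 X').choose_spec⟩

theorem tangleFilter_eq_gammaFilter_thetaToGamma (τ : Theta G) (X : Finset V) :
    tangleFilter τ.1 X = gammaFilter ((thetaToGamma τ).1 X) :=
  (exists_tangleFilter_eq_gammaFilter τ.2 X).choose_spec

theorem bijective_thetaToGamma : Function.Bijective (thetaToGamma : Theta G → Gamma G) := by
  refine ⟨fun τ τ' h => Subtype.ext (Theta.ext τ.2 τ'.2 fun X => ?_), fun γ => ?_⟩
  · rw [tangleFilter_eq_gammaFilter_thetaToGamma, h, tangleFilter_eq_gammaFilter_thetaToGamma]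
  · refine ⟨⟨gammaTangle γ, gammaTangle_mem_Theta γ⟩, Subtype.ext (funext fun X => ?_)⟩
    refine gammaFilter_injective X ?_
    rw [← tangleFilter_eq_gammaFilter_thetaToGamma, tangleFilter_gammaTangle]

/-! ### Rays from concatenated walks -/

/-- From a sequence of walks, each starting where the previous one ends, one obtains a lazy
infinite walk running through them. -/
theorem exists_lazy_walk {x : ℕ → V} (p : ∀ n, G.Walk (x n) (x (n + 1))) :
    ∃ (w : ℕ → V) (k : ℕ → ℕ), (∀ t, w (t + 1) = w t ∨ G.Adj (w t) (w (t + 1))) ∧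
      Tendsto k atTop atTop ∧ ∀ t, w t ∈ (p (k t)).support := by
  -- A state records the index of the current walk, the current vertex and the part of that walk
  -- still ahead. When nothing is left the index rises while the vertex stays put; this is the lazy
  -- step.
  let S := Σ n : ℕ, Σ v : V, {q : G.Walk v (x (n + 1)) // q.support ⊆ (p n).support}
  have step : ∀ s : S, ∃ s' : S, (s'.2.1 = s.2.1 ∨ G.Adj s.2.1 s'.2.1) ∧
      ((s'.1 = s.1 ∧ s'.2.2.1.length + 1 = s.2.2.1.length) ∨ s'.1 = s.1 + 1) := by
    rintro ⟨n, v, q, hq⟩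
    cases q with
    | nil => exact ⟨⟨n + 1, x (n + 1), p (n + 1), fun _ h => h⟩, Or.inl rfl, Or.inr rfl⟩
    | @cons _ y _ hadj r =>
      exact ⟨⟨n, y, r, fun _ h => hq (by simp [h])⟩, Or.inr hadj, Or.inl ⟨rfl, rfl⟩⟩
  choose f hf hf' using step
  let s : ℕ → S := fun t => f^[t] ⟨0, x 0, p 0, fun _ h => h⟩
  have hs : ∀ t, s (t + 1) = f (s t) := fun t => Function.iterate_succ_apply' f t _
  have hmono : Monotone fun t => (s t).1 := monotone_nat_of_le_succ fun t => by
    rw [hs]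
    rcases hf' (s t) with h | h <;> omega
  have hlen : ∀ l t, (s t).2.2.1.length ≤ l → ∃ t', (s t).1 + 1 ≤ (s t').1 := by
    intro l
    induction l with
    | zero =>
      intro t ht
      refine ⟨t + 1, ?_⟩
      rw [hs]
      rcases hf' (s t) with h | h <;> omega
    | succ l ih =>
      intro t ht
      rcases hf' (s t) with h | h
      · obtain ⟨t', ht'⟩ := ih (t + 1) (by rw [hs]; omega)
        exact ⟨t', by rw [hs, h.1] at ht'; exact ht'⟩
      · exact ⟨t + 1, by rw [hs]; omega⟩
  have hadj : ∀ t, (s (t + 1)).2.1 = (s t).2.1 ∨ G.Adj (s t).2.1 (s (t + 1)).2.1 := fun t => by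
    rw [hs]
    exact hf (s t)
  refine ⟨fun t => (s t).2.1, fun t => (s t).1, hadj,
    tendsto_atTop_atTop_of_monotone hmono fun n => ?_,
    fun t => (s t).2.2.2 (SimpleGraph.Walk.start_mem_support _)⟩
  induction n with
  | zero => exact ⟨0, Nat.zero_le _⟩
  | succ n ih =>
    obtain ⟨t, ht⟩ := ih
    obtain ⟨t', ht'⟩ := hlen _ t le_rfl
    exact ⟨t', by omega⟩

/-- A lazy infinite walk that visits every vertex only finitely often contains a ray: follow the
last visits. -/
theorem exists_ray_of_lazy_walk {w : ℕ → V} (hw : ∀ t, w (t + 1) = w t ∨ G.Adj (w t) (w (t + 1)))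
    (hfin : ∀ v, {t | w t = v}.Finite) :
    ∃ (r : Ray G) (t : ℕ → ℕ), StrictMono t ∧ ∀ n, r.vert n = w (t n) := by
  have hlast : ∀ i, ∃ j, i ≤ j ∧ w j = w i ∧ ∀ k, w k = w i → k ≤ j := by
    intro i
    obtain ⟨j, hj, hmax⟩ := Set.exists_max_image _ id (hfin (w i)) ⟨i, rfl⟩
    exact ⟨j, hmax i rfl, hj, hmax⟩
  choose l hil hwl hmax using hlast
  let t : ℕ → ℕ := fun n => Nat.rec (l 0) (fun _ i => l (i + 1)) n
  have ht : ∀ n, t (n + 1) = l (t n + 1) := fun _ => rfl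
  have htmax : ∀ n k, w k = w (t n) → k ≤ t n := by
    intro n k hk
    cases n with
    | zero => exact hmax 0 k (hk.trans (hwl 0))
    | succ n => exact hmax _ k (hk.trans (hwl _))
  have hmono : StrictMono t := strictMono_nat_of_lt_succ fun n => by
    have := hil (t n + 1)
    rw [ht]
    omega
  refine ⟨⟨fun n => w (t n), fun m n h => ?_, fun n => ?_⟩, t, hmono, fun _ => rfl⟩
  · exact hmono.injective (le_antisymm (htmax n _ h) (htmax m _ h.symm))
  · rw [ht, hwl]
    -- Staying put would make t n + 1 a visit to the same vertex after its last one.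
    refine (hw (t n)).resolve_left fun h => ?_
    have := htmax n _ h
    omega

theorem exists_ray_of_walks {x : ℕ → V} (p : ∀ n, G.Walk (x n) (x (n + 1)))
    (hfin : ∀ v, {n | v ∈ (p n).support}.Finite) :
    ∃ r : Ray G, ∀ N, ∃ M, ∀ m, M ≤ m → ∃ n, N ≤ n ∧ r.vert m ∈ (p n).support := by
  obtain ⟨w, k, hw, hk, hwk⟩ := exists_lazy_walk p
  obtain ⟨r, t, ht, hr⟩ := exists_ray_of_lazy_walk hw (fun v => by
    obtain ⟨B, hB⟩ := (hfin v).bddAbove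
    obtain ⟨T, hT⟩ := eventually_atTop.mp (hk.eventually_ge_atTop (B + 1))
    refine (Set.finite_lt_nat T).subset fun i hi => ?_
    by_contra hTi
    have h1 := hT i (not_lt.mp hTi)
    have h2 := hB (show k i ∈ {n | v ∈ (p n).support} from hi ▸ hwk i)
    omega)
  refine ⟨r, fun N => ?_⟩
  obtain ⟨M, hM⟩ := eventually_atTop.mp ((hk.comp ht.tendsto_atTop).eventually_ge_atTop N)
  exact ⟨M, fun m hm => ⟨k (t m), hM m hm, hr m ▸ hwk (t m)⟩⟩

/-! ### Every direction is defined by an end -/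

section Direction

variable {f : ∀ X : Finset V, G.ComponentCompl X}

/-- All but finitely many of the walks avoid X, and late ones start in f X, so they lie in f X, and
with them a tail of the ray. -/
theorem exists_end_of_walks {x : ℕ → V} (p : ∀ n, G.Walk (x n) (x (n + 1)))
    (hfin : ∀ v, {n | v ∈ (p n).support}.Finite)
    (hf : ∀ X, ∃ N, ∀ n, N ≤ n → x n ∉ X → x n ∈ f X) : ∃ ω : End G, ∀ X, endComp X ω = f X := by
  obtain ⟨r, hr⟩ := exists_ray_of_walks p hfin
  refine ⟨Quotient.mk (raySetoid G) r, fun X => ?_⟩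
  obtain ⟨N, hN⟩ := hf X
  have hX : {n | ∃ v ∈ X, v ∈ (p n).support}.Finite := by
    have : {n | ∃ v ∈ X, v ∈ (p n).support} =
        ⋃ v ∈ (X : Set V), {n | v ∈ (p n).support} := by ext; simp
    rw [this]
    exact X.finite_toSet.biUnion fun v _ => hfin v
  obtain ⟨B, hB⟩ := hX.bddAbove
  obtain ⟨M, hM⟩ := hr (max N (B + 1))
  refine (r.existsUnique_hasTailIn X).unique (r.hasTailIn_endComp X) ⟨M, fun m hm => ?_⟩
  obtain ⟨n, hn, hmem⟩ := hM m hm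
  have hdisj : ∀ v ∈ (p n).support, v ∉ (X : Set V) := fun v hv hvX => by
    have := hB (show n ∈ {n | ∃ v ∈ X, v ∈ (p n).support} from ⟨v, hvX, hv⟩)
    omega
  exact mem_of_walk (p n) (hN n (by omega) (hdisj _ (p n).start_mem_support)) hdisj _ hmem

theorem exists_end_of_infinite_dominating
    (hU : {v | ∀ X : Finset V, v ∉ X → v ∈ f X}.Infinite) :
    ∃ ω : End G, ∀ X, endComp X ω = f X := by
  classical
  set U := {v | ∀ X : Finset V, v ∉ X → v ∈ f X} with hUdef
  -- A state is a finite set of used vertices and a current dominating vertex outside it.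
  let S := {s : Finset V × V // s.2 ∈ U ∧ s.2 ∉ s.1}
  have step : ∀ s : S, ∃ (s' : S) (p : G.Walk s.1.2 s'.1.2), (∀ v ∈ p.support, v ∉ s.1.1) ∧
      s.1.1 ⊆ s'.1.1 ∧ (∀ v ∈ p.support, v = s'.1.2 ∨ v ∈ s'.1.1) ∧ s.1.2 ∈ s'.1.1 := by
    rintro ⟨⟨Z, u⟩, hu, huZ⟩
    obtain ⟨u', hu', hu'Z⟩ := hU.exists_notMem_finset (insert u Z)
    rw [Finset.mem_insert, not_or] at hu'Z
    obtain ⟨p, hp⟩ := exists_walk_of_mem (hu Z huZ) (hu' Z hu'Z.2)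
    -- The new endpoint u' is kept out of the used set because the next walk starts there. Hence
    -- only walks two or more steps apart are guaranteed to be disjoint.
    refine ⟨⟨⟨(Z ∪ p.support.toFinset).erase u', u'⟩, hu', by simp⟩, p,
      fun v hv => SimpleGraph.ComponentCompl.notMem_of_mem (hp v hv), ?_, ?_, ?_⟩
    · intro v hv
      simp only [Finset.mem_erase, Finset.mem_union]
      exact ⟨fun h => hu'Z.2 (h ▸ hv), Or.inl hv⟩
    · intro v hv
      by_cases h : v = u'
      · exact Or.inl h
      · exact Or.inr (by simp [h, hv])
    · simp [Ne.symm hu'Z.1]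
  choose g p hpZ hgZ hpg hug using step
  obtain ⟨u0, hu0⟩ := hU.nonempty
  let s : ℕ → S := fun n => g^[n] ⟨⟨∅, u0⟩, hu0, by simp⟩
  have hs : ∀ n, s (n + 1) = g (s n) := fun n => Function.iterate_succ_apply' g n _
  have hmono : Monotone fun n => (s n).1.1 := monotone_nat_of_le_succ fun n => by
    rw [hs]
    exact hgZ (s n)
  have hq : ∀ n, ∃ q : G.Walk (s n).1.2 (s (n + 1)).1.2, (∀ v ∈ q.support, v ∉ (s n).1.1) ∧
      (∀ v ∈ q.support, v ∈ (s (n + 2)).1.1) := by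
    intro n
    rw [hs (n + 1), hs n]
    refine ⟨p (s n), hpZ _, fun v hv => ?_⟩
    rcases hpg (s n) v hv with rfl | h
    · exact hug _
    · exact hgZ _ h
  choose q hq1 hq2 using hq
  refine exists_end_of_walks (x := fun n => (s n).1.2) q (fun v => ?_) fun X =>
    ⟨0, fun n _ h => (s n).2.1 X h⟩
  by_cases hv : ∃ n, v ∈ (q n).support
  · obtain ⟨n, hn⟩ := hv
    refine (Set.finite_lt_nat (n + 2)).subset fun m hm => ?_
    by_contra hle
    exact hq1 m v hm (hmono (not_lt.mp hle) (hq2 n v hn))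
  · exact Set.finite_empty.subset fun n hn => hv ⟨n, hn⟩

variable (hf : ∀ (X X' : Finset V) (h : X ⊆ X'), (f X').hom (Finset.coe_subset.mpr h) = f X)
include hf

theorem direction_anti {X X' : Finset V} (h : X ⊆ X') : (f X' : Set V) ⊆ f X := by
  rw [← hf X X' h]
  exact SimpleGraph.ComponentCompl.subset_hom _ _

/-- Join points of f (X n) and f (X (n + 1)) inside f (X n); a vertex outside some f (X n) is on no
later walk. For m large, f (X m) avoids a given Z and so lies in f Z. -/
theorem exists_end_of_iInter_eq_empty {X : ℕ → Finset V} (hX : Monotone X)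
    (hemp : ∀ v, ∃ n, v ∉ f (X n)) : ∃ ω : End G, ∀ Z, endComp Z ω = f Z := by
  classical
  have hanti : ∀ {m n}, m ≤ n → ∀ v ∈ f (X n), v ∈ f (X m) :=
    fun h v hv => direction_anti hf (hX h) hv
  choose x hx using fun n => (f (X n)).nonempty
  choose p hp using fun n => exists_walk_of_mem (hx n) (hanti n.le_succ _ (hx (n + 1)))
  refine exists_end_of_walks (x := x) p (fun v => ?_) fun Z => ?_
  · obtain ⟨n, hn⟩ := hemp v
    refine (Set.finite_lt_nat n).subset fun m hm => ?_
    by_contra hle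
    exact hn (hanti (not_lt.mp hle) v (hp m v hm))
  · choose n hn using hemp
    refine ⟨Z.sup n, fun m hm hxZ => ?_⟩
    have hdisj : ∀ v ∈ f (X m), v ∉ (Z : Set V) := fun v hv hvZ =>
      hn v (hanti ((Finset.le_sup hvZ).trans hm) v hv)
    obtain ⟨v, hv⟩ := (f (X m ∪ Z)).nonempty
    exact subset_of_disjoint (f Z) (f (X m)) hdisj
      (direction_anti hf Finset.subset_union_right hv)
      (direction_anti hf Finset.subset_union_left hv) (hx m)

/-- Each vertex w outside U has a witness Z w avoiding it with w ∉ f (Z w). Adding the witnesses of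
all vertices of X n to form X (n + 1) ensures that a neighbour outside U of f (X (n + 1)) lies in f
(X n). -/
theorem exists_end_of_finite_dominating
    (hU : {v | ∀ X : Finset V, v ∉ X → v ∈ f X}.Finite) :
    ∃ ω : End G, ∀ X, endComp X ω = f X := by
  classical
  obtain ⟨U, hU⟩ := hU.exists_finset_coe
  have hsep : ∀ v, ∃ Z : Finset V, v ∉ U → v ∉ Z ∧ v ∉ f Z := by
    intro v
    by_cases hv : v ∈ U
    · exact ⟨∅, fun h => absurd hv h⟩
    · have : v ∉ {v | ∀ X : Finset V, v ∉ X → v ∈ f X} := by rw [← hU]; exact hv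
      simp only [Set.mem_ofPred_eq, not_forall] at this
      obtain ⟨Z, h1, h2⟩ := this
      exact ⟨Z, fun _ => ⟨h1, h2⟩⟩
  choose Z hZ using hsep
  obtain ⟨x, hx⟩ := (f U).nonempty
  let X : ℕ → Finset V := fun n => Nat.rec (insert x U) (fun _ Y => Y ∪ Y.biUnion Z) n
  have hXs : ∀ n, X (n + 1) = X n ∪ (X n).biUnion Z := fun _ => rfl
  have hmono : Monotone X := monotone_nat_of_le_succ fun n => by
    rw [hXs]
    exact Finset.subset_union_left
  have hxX : x ∈ X 0 := Finset.mem_insert_self _ _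
  have hUX : U ⊆ X 0 := Finset.subset_insert _ _
  have step : ∀ n, ∀ v ∈ f (X (n + 1)), ∀ w, G.Adj v w → w ∉ U → w ∈ f (X n) := by
    intro n v hv w hvw hw
    rcases em (w ∈ X n) with hwX | hwX
    · have hsub : Z w ⊆ X (n + 1) := by
        rw [hXs]
        exact (Finset.subset_biUnion_of_mem Z hwX).trans Finset.subset_union_right
      exact absurd (SimpleGraph.ComponentCompl.mem_of_adj v w (direction_anti hf hsub hv)
        (hZ w hw).1 hvw) (hZ w hw).2
    · exact SimpleGraph.ComponentCompl.mem_of_adj v w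
        (direction_anti hf (hmono n.le_succ) hv) hwX hvw
  have hwalk : ∀ {a b : V} (p : G.Walk a b), (∀ v ∈ p.support, v ∉ U) →
      a ∈ f (X p.length) → b ∈ f (X 0) := by
    intro a b p
    induction p with
    | nil => exact fun _ h => h
    | @cons a y b hadj q ih =>
      intro hp ha
      exact ih (fun v hv => hp v (by simp [hv])) (step _ a ha y hadj (hp y (by simp)))
  refine exists_end_of_iInter_eq_empty hf hmono fun v => ?_
  -- A vertex v in every f (X n) is joined to x by a walk in f U. Starting at index the length of
  -- the walk and losing one index per edge, one gets x ∈ f (X 0), although x was put into X 0.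
  by_contra! hv
  obtain ⟨p, hp⟩ := exists_walk_of_mem (direction_anti hf hUX (hv 0)) hx
  exact SimpleGraph.ComponentCompl.notMem_of_mem
    (hwalk p (fun w hw => SimpleGraph.ComponentCompl.notMem_of_mem (hp w hw)) (hv _)) hxX

theorem exists_end_of_direction : ∃ ω : End G, ∀ X, endComp X ω = f X := by
  by_cases hU : {v | ∀ X : Finset V, v ∉ X → v ∈ f X}.Finite
  · exact exists_end_of_finite_dominating hf hU
  · exact exists_end_of_infinite_dominating hU

end Direction

/-! ### The limit `Γ` consists of the ends and the critical vertex sets -/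

theorem endLimit_injective : Function.Injective (endLimit G) := by
  intro ω ω' h
  induction ω using Quotient.inductionOn with | _ r => ?_
  induction ω' using Quotient.inductionOn with | _ s => ?_
  refine Quotient.sound fun X => ⟨_, r.hasTailIn_endComp X, ?_⟩
  have : endComp X (Quotient.mk (raySetoid G) r) = endComp X (Quotient.mk (raySetoid G) s) :=
    Sum.inl_injective (congrFun (congrArg Subtype.val h) X)
  rw [this]
  exact s.hasTailIn_endComp X

theorem critLimit_apply_of_subset {Y : Crit G} {X : Finset V} (h : Y.1 ⊆ X) :
    (critLimit G Y).1 X = Sum.inr ⟨Y.1, Y.2, h⟩ :=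
  dite_cond_eq_true (eq_true h)

theorem critLimit_injective : Function.Injective (critLimit G) := by
  classical
  intro Y Z h
  have := congrFun (congrArg Subtype.val h) (Y.1 ∪ Z.1)
  rw [critLimit_apply_of_subset Finset.subset_union_left,
    critLimit_apply_of_subset Finset.subset_union_right] at this
  have := Sum.inr_injective this
  exact Subtype.ext (Subtype.mk.inj this)

theorem endLimit_ne_critLimit (ω : End G) (Y : Crit G) : endLimit G ω ≠ critLimit G Y := by
  intro h
  have := congrFun (congrArg Subtype.val h) Y.1
  rw [critLimit_apply_of_subset subset_rfl] at this
  exact Sum.inl_ne_inr this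

/-- Bonding maps send components to components, so the coordinate at X ∪ Z must be a critical set
mapping to Y, hence Y itself; it determines the coordinate at Z. -/
theorem critLimit_eq_of_apply_eq_inr (γ : Gamma G) {X : Finset V} {Y : CritSub G X}
    (h : γ.1 X = Sum.inr Y) : critLimit G ⟨Y.1, Y.2.1⟩ = γ := by
  classical
  refine Subtype.ext (funext fun Z => ?_)
  rw [← (critLimit G ⟨Y.1, Y.2.1⟩).2 Z (X ∪ Z) Finset.subset_union_right,
    ← γ.2 Z (X ∪ Z) Finset.subset_union_right,
    critLimit_apply_of_subset (Y.2.2.trans Finset.subset_union_left)]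
  congr 1
  have hX := (γ.2 X (X ∪ Z) Finset.subset_union_left).trans h
  rcases hγ : γ.1 (X ∪ Z) with C | W
  · rw [hγ] at hX
    exact absurd hX Sum.inl_ne_inr
  · rw [hγ] at hX
    simp only [bonding] at hX
    split_ifs at hX
    exact congrArg Sum.inr (Subtype.ext (congrArg Subtype.val (Sum.inr_injective hX)).symm)

theorem bijective_elim_endLimit_critLimit :
    Function.Bijective (Sum.elim (endLimit G) (critLimit G)) := by
  refine ⟨endLimit_injective.sumElim critLimit_injective endLimit_ne_critLimit, fun γ => ?_⟩
  by_cases h : ∃ (X : Finset V) (Y : CritSub G X), γ.1 X = Sum.inr Y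
  · obtain ⟨X, Y, hY⟩ := h
    exact ⟨Sum.inr _, critLimit_eq_of_apply_eq_inr γ hY⟩
  · have hC : ∀ X, ∃ C, γ.1 X = Sum.inl C := by
      intro X
      rcases hγ : γ.1 X with C | Y
      · exact ⟨C, rfl⟩
      · exact absurd ⟨X, Y, hγ⟩ h
    choose f hf using hC
    obtain ⟨ω, hω⟩ := exists_end_of_direction (f := f) fun X X' hXX' => by
      have := γ.2 X X' hXX'
      rw [hf, hf] at this
      exact Sum.inl_injective this
    refine ⟨Sum.inl ω, Subtype.ext (funext fun X => ?_)⟩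
    rw [hf X, ← hω X]
    rfl

end EndsTangles

theorem theorem5p10 {V : Type*} (G : SimpleGraph V) :
    (∀ τ ∈ EndsTangles.Theta G, ∀ X : Finset V,
      ∃! ξ : EndsTangles.GammaAt G X,
        EndsTangles.tangleFilter τ X = EndsTangles.gammaFilter ξ) ∧
    (∃ Φ : EndsTangles.Theta G → EndsTangles.Gamma G,
      (∀ (τ : EndsTangles.Theta G) (X : Finset V),
        EndsTangles.tangleFilter τ.1 X = EndsTangles.gammaFilter ((Φ τ).1 X)) ∧
      Function.Bijective Φ) ∧
    Function.Bijective
      (Sum.elim (EndsTangles.endLimit G) (EndsTangles.critLimit G) :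
        EndsTangles.End G ⊕ EndsTangles.Crit G → EndsTangles.Gamma G) := by
  refine ⟨fun τ hτ X => ?_, ⟨EndsTangles.thetaToGamma,
    EndsTangles.tangleFilter_eq_gammaFilter_thetaToGamma, EndsTangles.bijective_thetaToGamma⟩,
    EndsTangles.bijective_elim_endLimit_critLimit⟩
  obtain ⟨ξ, hξ⟩ := EndsTangles.exists_tangleFilter_eq_gammaFilter hτ X
  exact ⟨ξ, hξ, fun ξ' hξ' => EndsTangles.gammaFilter_injective X (hξ'.symm.trans hξ)⟩
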